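/- Let $S$ be a countable set and let $(X_t)_{t\ge 0}$ be a time-homogeneous Markov process on $S$ with transition rates $(a(i,j))_{i,j\in S}$ (finite total jump rate $\sum_{j\ne i}a(i,j)$ in each state; no symmetry is assumed) and transition probabilities $p_t(i,j)=\mathbb{P}[X_t=j\mid X_0=i]$. Fix $i\in S$, let the process start in $X_0=i$, and let $L_t=\int_0^t \mathbf 1_{\{X_s=i\}}\,ds$ be its local time in $i$. Put $$G_\infty=\int_0^\infty p_t(i,i)\,dt,\qquad H_\infty=\int_0^\infty t\,p_t(i,i)\,dt ,$$ and write $h_1\sim h_2$ for $\lim h_1/h_2=1$. Suppose that $p_t(i,i)\sim c\,t^{-\alpha}$ as $t\to\infty$, where $c>0$ and $\alpha>1$ (so that $0<G_\infty<\infty$), and let $\kappa=1/G_\infty$. Then, as $t\to\infty$, $$\mathbb{E}\big[e^{\kappa L_t}\big]\sim\begin{cases} \dfrac{\alpha-1}{\kappa\, c\,\Gamma(2-\alpha)\,\Gamma(\alpha)}\;t^{\alpha-1} &: 1<\alpha<2,\\[2mm] \dfrac{1}{\kappa c}\;\dfrac{t}{\log t} &: \alpha=2,\\[2mm] \dfrac{1}{\kappa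 H_\infty}\;t &: \alpha>2,\end{cases}$$ where in the last case $H_\infty<\infty$. -/

import Mathlib

open MeasureTheory Filter Asymptotics
open scoped NNReal ENNReal

namespace CriticalLocalTime

variable {S : Type*}

open scoped Classical in
/-- An honest (stochastic) transition function `p t i j` on the state space `S`. -/
structure IsTransitionFunction (p : ℝ≥0 → S → S → ℝ) : Prop where
  nonneg : ∀ t i j, 0 ≤ p t i j
  hasSum_one : ∀ t i, HasSum (fun j => p t i j) 1
  zero : ∀ i j, p 0 i j = if i = j then 1 else 0
  chapman_kolmogorov : ∀ s t i j, HasSum (fun k => p s i k * p t k j) (p (s + t) i j)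

/-- The transition function `p` has transition rates `a i j` (`i ≠ j`), with finite total jump
rate in every state: these are the right derivatives of `p` at time `0`. The diagonal
entries `a i i` play no role for the dynamics. -/
structure HasTransitionRates (a : S → S → ℝ) (p : ℝ≥0 → S → S → ℝ) : Prop where
  nonneg : ∀ i j, j ≠ i → 0 ≤ a i j
  summable : ∀ i, Summable (fun j : {j : S // j ≠ i} => a i j)
  offDiag : ∀ i j, j ≠ i →
    HasDerivWithinAt (fun t : ℝ => p t.toNNReal i j) (a i j) (Set.Ici 0) 0
  diag : ∀ i,
    HasDerivWithinAt (fun t : ℝ => p t.toNNReal i i) (-∑' j : {j : S // j ≠ i}, a i j)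
      (Set.Ici 0) 0

open scoped Classical in
/-- `X` is, under `P`, a (jointly measurable) time-homogeneous Markov process with transition
function `p` started in `i`: its finite-dimensional distributions are
`P(X_0 = x_0, X_{t_1} = x_1, …, X_{t_n} = x_n) = 1_{x_0 = i} ∏ p_{t_{k+1} - t_k}(x_k, x_{k+1})`
for `0 = t_0 ≤ t_1 ≤ … ≤ t_n`. Joint measurability holds in particular when the paths are
right-continuous for the discrete topology of `S`. -/
structure IsMarkovProcess {Ω : Type*} [MeasurableSpace Ω] [MeasurableSpace S] (P : Measure Ω)
    (X : ℝ≥0 → Ω → S) (p : ℝ≥0 → S → S → ℝ) (i : S) : Prop where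
  measurable : Measurable (fun z : ℝ≥0 × Ω => X z.1 z.2)
  finiteDim : ∀ (n : ℕ) (t : Fin (n + 1) → ℝ≥0) (x : Fin (n + 1) → S), Monotone t → t 0 = 0 →
    P {ω | ∀ k, X (t k) ω = x k} =
      ENNReal.ofReal ((if x 0 = i then 1 else 0) *
        ∏ k : Fin n, p (t k.succ - t k.castSucc) (x k.castSucc) (x k.succ))

open scoped Classical in
/-- The local time `L_t = ∫_0^t 1_{X_s = i} ds` of `X` in the state `i`. -/
noncomputable def localTime {Ω : Type*} (X : ℝ≥0 → Ω → S) (i : S) (t : ℝ≥0) (ω : Ω) : ℝ :=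
  ∫ s in (0 : ℝ)..t, if X s.toNNReal ω = i then (1 : ℝ) else 0

/-- The Green function `G_∞(i,j) = ∫_0^∞ p_t(i,j) dt`, possibly infinite. -/
noncomputable def greenFunction (p : ℝ≥0 → S → S → ℝ) (i j : S) : ℝ≥0∞ :=
  ∫⁻ t in Set.Ici (0 : ℝ), ENNReal.ofReal (p t.toNNReal i j)

/-- `H_∞(i,j) = ∫_0^∞ t p_t(i,j) dt`, possibly infinite. -/
noncomputable def weightedGreenFunction (p : ℝ≥0 → S → S → ℝ) (i j : S) : ℝ≥0∞ :=
  ∫⁻ t in Set.Ici (0 : ℝ), ENNReal.ofReal (t * p t.toNNReal i j)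

end CriticalLocalTime

/-! Put `M t = E[exp (κ L_t)]`. Differentiating `exp (κ ∫_s^t 1_{X_u = i} du)` in `s` and applying
the Markov property at time `s` gives the renewal equation `M = 1 + φ * M` with `φ t = κ p_t(i,i)`
(`IsMarkovProcess.renewal_equation`). The choice `κ = 1 / G_∞` is critical: it makes `φ` a
probability density.

Laplace transforms turn the equation into `s ∫ e^{-st} M t dt = 1 / D s`, where `D s = ∫ (1 -
e^{-st}) φ t dt` tends to zero with `s` (`IsRenewalFunction.mul_laplace_eq`). The tail `φ t ~ κ c
t^{-α}` fixes the rate: `D s` behaves like a constant times `s^{α-1}`, `s log (1/s)` or `s`,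
according as `α < 2`, `α = 2` or `α > 2`. As `M` is monotone, Karamata's theorem
(`tendsto_div_of_laplace_regularlyVarying`) inverts the transform: `M t ~ 1 / (Γ(ρ+1) D(1/t))`, with
`ρ = α - 1` in the first case and `ρ = 1` in the other two.

The Markov property is available only through finite-dimensional distributions. It reaches the path
functional `exp (κ L)` by way of its power series, whose coefficients are integrals of joint visit
probabilities (`integral_exp_intervalIntegral_congr`). -/

namespace CriticalLocalTime

/-! ### Pathwise identity for the exponential of an occupation time -/

section ExponentialFormula

open Set

lemma intervalIntegrable_of_mem_Icc {g : ℝ → ℝ} (hg : Measurable g) (h : ∀ s, g s ∈ Icc (0 : ℝ) 1)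
    (a b : ℝ) : IntervalIntegrable g volume a b :=
  (intervalIntegrable_const (c := (1 : ℝ))).mono_fun hg.aestronglyMeasurable
    (.of_forall fun s => by
      simpa [abs_of_nonneg (h s).1] using (h s).2)

lemma abs_intervalIntegral_le_of_mem_Icc {g : ℝ → ℝ} (h : ∀ s, g s ∈ Icc (0 : ℝ) 1) (a b : ℝ) :
    |∫ s in a..b, g s| ≤ |b - a| := by
  have := intervalIntegral.norm_integral_le_of_norm_le_const (f := g) (a := a) (b := b) (C := 1)
    (fun s _ => by rw [Real.norm_of_nonneg (h s).1]; exact (h s).2)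
  simpa using this

/-- A pathwise renewal identity for the exponential of an integral. -/
lemma exp_mul_integral_eq {g : ℝ → ℝ} (hg : Measurable g) (h : ∀ s, g s ∈ Icc (0 : ℝ) 1)
    (κ t : ℝ) :
    Real.exp (κ * ∫ u in (0 : ℝ)..t, g u) =
      1 + κ * ∫ s in (0 : ℝ)..t, g s * Real.exp (κ * ∫ u in s..t, g u) := by
  have hi := intervalIntegrable_of_mem_Icc hg h
  set L : ℝ → ℝ := fun s => κ * ∫ u in s..t, g u with hL
  -- `g` is only measurable, so `L` need not be differentiable everywhere. It is Lipschitz, hence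
  -- `exp ∘ L` is absolutely continuous and the fundamental theorem needs its derivative only almost
  -- everywhere.
  have hLip : LipschitzWith (Real.nnabs κ) L := by
    refine LipschitzWith.of_dist_le_mul fun x y => ?_
    have hsub : (∫ u in x..t, g u) - ∫ u in y..t, g u = ∫ u in x..y, g u := by
      rw [← intervalIntegral.integral_add_adjacent_intervals (hi x y) (hi y t), add_sub_cancel_right]
    rw [Real.dist_eq, hL, ← mul_sub, abs_mul, hsub, Real.dist_eq]
    simp only [Real.coe_nnabs]
    refine mul_le_mul_of_nonneg_left ?_ (abs_nonneg κ)
    rw [abs_sub_comm]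
    exact abs_intervalIntegral_le_of_mem_Icc h _ _
  obtain ⟨R, hR⟩ := (isCompact_uIcc (a := (0 : ℝ)) (b := t)).exists_bound_of_continuousOn
    hLip.continuous.continuousOn
  -- `exp` is not globally Lipschitz, but it is so on the bounded range `[-R, R]` of `L`.
  obtain ⟨K, hK⟩ := (Real.contDiff_exp (n := 1)).contDiffOn.exists_lipschitzOnWith (by decide)
    (convex_Icc (-R) R) isCompact_Icc
  have hAC : AbsolutelyContinuousOnInterval (fun s => Real.exp (L s)) 0 t :=
    (hK.comp (hLip.lipschitzOnWith (s := uIcc 0 t))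
      (fun x hx => abs_le.1 (hR x hx))).absolutelyContinuousOnInterval
  have hFTC := hAC.integral_deriv_eq_sub
  have hderiv : ∫ s in (0 : ℝ)..t, deriv (fun s => Real.exp (L s)) s =
      ∫ s in (0 : ℝ)..t, -(κ * (g s * Real.exp (L s))) := by
    refine intervalIntegral.integral_congr_ae ?_
    have hloc : LocallyIntegrable g volume := by
      refine (locallyIntegrable_const (1 : ℝ)).mono hg.aestronglyMeasurable (.of_forall fun s => ?_)
      rw [Real.norm_of_nonneg (h s).1]; simpa using (h s).2
    filter_upwards [LocallyIntegrable.ae_hasDerivAt_integral hloc] with s hs _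
    have h1 : HasDerivAt L (κ * -(g s)) s := by
      have := ((hs t).neg).const_mul κ
      refine this.congr_of_eventuallyEq (.of_forall fun x => ?_)
      simp only [hL, Pi.neg_apply]
      rw [intervalIntegral.integral_symm]
    rw [h1.exp.deriv]; ring
  rw [hderiv, intervalIntegral.integral_neg, intervalIntegral.integral_const_mul] at hFTC
  simp only [hL, intervalIntegral.integral_same, mul_zero, Real.exp_zero] at hFTC ⊢
  linarith

end ExponentialFormula

/-! ### Exponential moments from joint moments -/

section Moments

open Set

variable {Ω : Type*} [MeasurableSpace Ω]

lemma measurable_intervalIntegral_of_uncurry {Y : ℝ → Ω → ℝ}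
    (hY : Measurable fun z : ℝ × Ω => Y z.1 z.2) (a b : ℝ) :
    Measurable fun ω => ∫ u in a..b, Y u ω := by
  have h (A : Set ℝ) : StronglyMeasurable fun ω => ∫ u in A, Y u ω :=
    StronglyMeasurable.integral_prod_right (ν := volume.restrict A)
      (f := fun ω u => Y u ω) ((hY.comp measurable_swap).stronglyMeasurable)
  exact ((h _).sub (h _)).measurable

/-- The `n`-th power of an integral is an integral over the cube `(0, t]^n`; boundedness of `Y`
permits Fubini. -/
lemma integral_pow_intervalIntegral {Y : ℝ → Ω → ℝ}
    (hY : Measurable fun z : ℝ × Ω => Y z.1 z.2) (h : ∀ s ω, Y s ω ∈ Icc (0 : ℝ) 1)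
    (μ : Measure Ω) [IsFiniteMeasure μ] {t : ℝ} (ht : 0 ≤ t) (n : ℕ) :
    ∫ ω, (∫ u in (0 : ℝ)..t, Y u ω) ^ n ∂μ =
      ∫ u : Fin n → ℝ, ∫ ω, ∏ k, Y (u k) ω ∂μ
        ∂(Measure.pi fun _ => volume.restrict (Ioc 0 t)) := by
  have hmeas : Measurable fun z : Ω × (Fin n → ℝ) => ∏ k, Y (z.2 k) z.1 :=
    Finset.measurable_prod _ fun k _ =>
      hY.comp (g := fun z : ℝ × Ω => Y z.1 z.2) (f := fun z : Ω × (Fin n → ℝ) => (z.2 k, z.1))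
        (((measurable_pi_apply k).comp measurable_snd).prodMk measurable_fst)
  rw [← integral_integral_swap]
  · refine integral_congr_ae (.of_forall fun ω => ?_)
    simp only
    rw [intervalIntegral.integral_of_le ht,
      integral_fintype_prod_eq_pow (ι := Fin n) (fun u => Y u ω), Fintype.card_fin]
  · refine Integrable.of_bound hmeas.aestronglyMeasurable 1 (.of_forall fun z => ?_)
    rw [Function.uncurry, Real.norm_of_nonneg (Finset.prod_nonneg fun k _ => (h _ _).1)]
    exact Finset.prod_le_one (fun k _ => (h _ _).1) fun k _ => (h _ _).2

lemma hasSum_integral_exp {Z : Ω → ℝ} (hZ : Measurable Z) {B : ℝ} (hB : ∀ ω, |Z ω| ≤ B)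
    (μ : Measure Ω) [IsFiniteMeasure μ] (κ : ℝ) :
    HasSum (fun n : ℕ => κ ^ n / n.factorial * ∫ ω, Z ω ^ n ∂μ) (∫ ω, Real.exp (κ * Z ω) ∂μ) := by
  simp_rw [← integral_const_mul]
  refine hasSum_integral_of_dominated_convergence
    (fun n _ => (|κ| * B) ^ n / n.factorial) (fun n => by fun_prop) (fun n => .of_forall fun ω => ?_)
    (.of_forall fun ω => Real.summable_pow_div_factorial _) (by simp) (.of_forall fun ω => ?_)
  · rw [norm_mul, norm_div, norm_pow, norm_pow, Real.norm_natCast, Real.norm_eq_abs, Real.norm_eq_abs,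
      mul_pow, div_mul_eq_mul_div]
    gcongr
    exact hB ω
  · have := NormedSpace.expSeries_div_hasSum_exp (κ * Z ω)
    rw [← Real.exp_eq_exp_ℝ] at this
    refine this.congr_fun fun n => ?_
    rw [mul_pow]; ring

/-- The exponential moments of an occupation integral are determined by the joint moments of the
integrand. -/
lemma integral_exp_intervalIntegral_congr {Y Y' : ℝ → Ω → ℝ}
    (hY : Measurable fun z : ℝ × Ω => Y z.1 z.2) (h : ∀ s ω, Y s ω ∈ Icc (0 : ℝ) 1)
    (hY' : Measurable fun z : ℝ × Ω => Y' z.1 z.2) (h' : ∀ s ω, Y' s ω ∈ Icc (0 : ℝ) 1)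
    (μ μ' : Measure Ω) [IsFiniteMeasure μ] [IsFiniteMeasure μ'] {t : ℝ} (ht : 0 ≤ t)
    (heq : ∀ (n : ℕ) (u : Fin n → ℝ), (∀ k, 0 ≤ u k) →
      ∫ ω, ∏ k, Y (u k) ω ∂μ = ∫ ω, ∏ k, Y' (u k) ω ∂μ') (κ : ℝ) :
    ∫ ω, Real.exp (κ * ∫ u in (0 : ℝ)..t, Y u ω) ∂μ =
      ∫ ω, Real.exp (κ * ∫ u in (0 : ℝ)..t, Y' u ω) ∂μ' := by
  refine (hasSum_integral_exp (measurable_intervalIntegral_of_uncurry hY 0 t)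
    (fun ω => abs_intervalIntegral_le_of_mem_Icc (fun s => h s ω) 0 t) μ κ).unique ?_
  refine (hasSum_integral_exp (measurable_intervalIntegral_of_uncurry hY' 0 t)
    (fun ω => abs_intervalIntegral_le_of_mem_Icc (fun s => h' s ω) 0 t) μ' κ).congr_fun fun n => ?_
  congr 1
  rw [integral_pow_intervalIntegral hY h μ ht, integral_pow_intervalIntegral hY' h' μ' ht]
  refine integral_congr_ae ?_
  -- `heq` covers nonnegative times only, and the product measure charges no others.
  have hae : ∀ᵐ u ∂(Measure.pi fun _ : Fin n => volume.restrict (Ioc 0 t)), ∀ k, 0 ≤ u k := by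
    rw [ae_all_iff]
    intro k
    refine (Measure.quasiMeasurePreserving_eval _ k).ae ?_
    filter_upwards [ae_restrict_mem measurableSet_Ioc] with x hx using hx.1.le
  filter_upwards [hae] with u hu
  exact heq n u hu

end Moments

/-! ### The Markov property at visits to `i` and the renewal equation -/

section MarkovProcess

open Set

variable {S : Type*} {Ω : Type*}

open scoped Classical in
/-- The indicator of the event that `X` is in `i` at time `s`. -/
noncomputable def visitIndicator (X : ℝ≥0 → Ω → S) (i : S) (s : ℝ) (ω : Ω) : ℝ :=
  if X s.toNNReal ω = i then 1 else 0

lemma visitIndicator_mem_Icc (X : ℝ≥0 → Ω → S) (i : S) (s : ℝ) (ω : Ω) :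
    visitIndicator X i s ω ∈ Icc (0 : ℝ) 1 := by
  unfold visitIndicator
  split_ifs <;> simp

lemma localTime_eq (X : ℝ≥0 → Ω → S) (i : S) (t : ℝ≥0) (ω : Ω) :
    localTime X i t ω = ∫ s in (0 : ℝ)..t, visitIndicator X i s ω := rfl

lemma prod_visitIndicator (X : ℝ≥0 → Ω → S) (i : S) {n : ℕ} (u : Fin n → ℝ) (ω : Ω) :
    ∏ k, visitIndicator X i (u k) ω =
      {ω | ∀ k, X (u k).toNNReal ω = i}.indicator (1 : Ω → ℝ) ω := by
  classical
  simp only [visitIndicator, Finset.prod_ite_zero, Finset.prod_const_one, indicator,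
    Finset.mem_univ, true_implies, mem_ofPred_eq, Pi.one_apply]

namespace IsMarkovProcess

variable [MeasurableSpace S] [DiscreteMeasurableSpace S] [MeasurableSpace Ω]
  {P : Measure Ω} {X : ℝ≥0 → Ω → S} {p : ℝ≥0 → S → S → ℝ} {i : S}

lemma measurable_visitIndicator (hX : IsMarkovProcess P X p i) :
    Measurable fun z : ℝ × Ω => visitIndicator X i z.1 z.2 := by
  classical
  refine Measurable.ite ?_ measurable_const measurable_const
  have h : Measurable fun z : ℝ × Ω => X z.1.toNNReal z.2 :=
    hX.measurable.comp (g := fun z : ℝ≥0 × Ω => X z.1 z.2)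
      ((measurable_real_toNNReal.comp measurable_fst).prodMk measurable_snd)
  exact h (MeasurableSet.of_discrete (s := {i}))

lemma measurableSet_forall_eq (hX : IsMarkovProcess P X p i) {n : ℕ} (u : Fin n → ℝ≥0) :
    MeasurableSet {ω | ∀ k, X (u k) ω = i} := by
  rw [ofPred_forall]
  refine MeasurableSet.iInter fun k => ?_
  exact (hX.measurable.comp (g := fun z : ℝ≥0 × Ω => X z.1 z.2)
    (measurable_const.prodMk measurable_id)) (MeasurableSet.of_discrete (s := {i}))

/-- `finiteDim` wants a time vector starting at `0`; prepending `0` is harmless because `X 0 = i`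
almost surely. -/
lemma measure_forall_eq_of_monotone [IsProbabilityMeasure P] (hX : IsMarkovProcess P X p i)
    {n : ℕ} {u : Fin n → ℝ≥0} (hu : Monotone u) :
    P {ω | ∀ k, X (u k) ω = i} = ENNReal.ofReal
      (∏ k : Fin n, p ((Fin.cons 0 u : Fin (n + 1) → ℝ≥0) k.succ -
        (Fin.cons 0 u : Fin (n + 1) → ℝ≥0) k.castSucc) i i) := by
  have hmono : Monotone (Fin.cons 0 u : Fin (n + 1) → ℝ≥0) := by
    intro a b hab
    induction a using Fin.cases with
    | zero => simp
    | succ a =>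
      induction b using Fin.cases with
      | zero => simp at hab
      | succ b => simpa using hu (by simpa using hab)
  have h0 : P {ω | X 0 ω = i} = 1 := by
    have := hX.finiteDim 0 (fun _ => 0) (fun _ => i) monotone_const rfl
    simpa using this
  have h0' : ∀ᵐ ω ∂P, X 0 ω = i := by
    rw [← mem_ae_iff_prob_eq_one₀] at h0
    · exact h0
    · have := hX.measurableSet_forall_eq (n := 1) (fun _ => 0)
      exact (by simpa using this : MeasurableSet {ω | X 0 ω = i}).nullMeasurableSet
  have := hX.finiteDim n (Fin.cons 0 u) (fun _ => i) hmono rfl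
  rw [if_pos rfl, one_mul] at this
  rw [← this]
  refine measure_congr ?_
  filter_upwards [h0'] with ω hω
  refine propext ?_
  change (∀ k, X (u k) ω = i) ↔ ∀ k : Fin (n + 1), X ((Fin.cons 0 u : Fin (n + 1) → ℝ≥0) k) ω = i
  rw [Fin.forall_fin_succ]
  simp [hω]

/-- Both probabilities are products of return probabilities over time increments. Shifting by `s`
preserves the increments and contributes one extra factor `p s i i`. -/
lemma measure_forall_eq_add [IsProbabilityMeasure P] (hX : IsMarkovProcess P X p i)
    (hp : IsTransitionFunction p) {n : ℕ} (s : ℝ≥0) (u : Fin n → ℝ≥0) :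
    P ({ω | ∀ k, X (s + u k) ω = i} ∩ {ω | X s ω = i}) =
      ENNReal.ofReal (p s i i) * P {ω | ∀ k, X (u k) ω = i} := by
  -- The moment integrals run over the whole cube, so times come unordered; sorting them does not
  -- change the events.
  wlog hu : Monotone u generalizing u
  · have := this (u ∘ Tuple.sort u) (Tuple.monotone_sort u)
    simp only [Function.comp_apply] at this
    have h1 (ω : Ω) : (∀ k, X (s + u (Tuple.sort u k)) ω = i) ↔ ∀ k, X (s + u k) ω = i :=
      (Tuple.sort u).forall_congr_left (p := fun k => X (s + u (Tuple.sort u k)) ω = i) |>.trans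
        (by simp)
    have h2 (ω : Ω) : (∀ k, X (u (Tuple.sort u k)) ω = i) ↔ ∀ k, X (u k) ω = i :=
      (Tuple.sort u).forall_congr_left (p := fun k => X (u (Tuple.sort u k)) ω = i) |>.trans
        (by simp)
    simpa only [h1, h2] using this
  have hmono : Monotone (Fin.cons s (fun k => s + u k) : Fin (n + 1) → ℝ≥0) := by
    intro a b hab
    induction a using Fin.cases with
    | zero => induction b using Fin.cases <;> simp
    | succ a =>
      induction b using Fin.cases with
      | zero => simp at hab
      | succ b => simpa using hu (by simpa using hab)
  have hset : {ω | ∀ k, X (s + u k) ω = i} ∩ {ω | X s ω = i} =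
      {ω | ∀ k, X ((Fin.cons s (fun k => s + u k) : Fin (n + 1) → ℝ≥0) k) ω = i} := by
    ext ω
    simp [Fin.forall_fin_succ, and_comm]
  have hcons : (Fin.cons s (fun k => s + u k) : Fin (n + 1) → ℝ≥0) =
      fun k => s + (Fin.cons 0 u : Fin (n + 1) → ℝ≥0) k := by
    ext k
    induction k using Fin.cases <;> simp
  rw [hset, hX.measure_forall_eq_of_monotone hmono, hX.measure_forall_eq_of_monotone hu,
    ← ENNReal.ofReal_mul (hp.nonneg _ _ _), Fin.prod_univ_succ]
  congr 2
  · simp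
  · refine Finset.prod_congr rfl fun k _ => ?_
    rw [hcons, ← Fin.succ_castSucc]
    simp only [Fin.cons_succ, add_tsub_add_eq_tsub_left]

lemma measure_eq [IsProbabilityMeasure P] (hX : IsMarkovProcess P X p i) (s : ℝ≥0) :
    P {ω | X s ω = i} = ENNReal.ofReal (p s i i) := by
  have := hX.measure_forall_eq_of_monotone (n := 1) (u := fun _ => s) monotone_const
  simpa using this

/-- The process shifted by `s`, under `P` restricted to `{X_s = i}`, has the same joint visit
moments as `X` under `p_s(i,i) • P`; hence the exponential moments agree too. -/
lemma integral_visitIndicator_mul_exp [IsProbabilityMeasure P] (hX : IsMarkovProcess P X p i)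
    (hp : IsTransitionFunction p) (κ : ℝ) {s t : ℝ} (hs : 0 ≤ s) (hst : s ≤ t) :
    ∫ ω, visitIndicator X i s ω * Real.exp (κ * ∫ u in s..t, visitIndicator X i u ω) ∂P =
      p s.toNNReal i i *
        ∫ ω, Real.exp (κ * ∫ u in (0 : ℝ)..(t - s), visitIndicator X i u ω) ∂P := by
  have hA : MeasurableSet {ω | X s.toNNReal ω = i} := by
    have := hX.measurableSet_forall_eq (n := 1) (fun _ => s.toNNReal)
    simpa using this
  have hmeas := hX.measurable_visitIndicator
  have : IsFiniteMeasure (ENNReal.ofReal (p s.toNNReal i i) • P) :=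
    P.smul_finite ENNReal.ofReal_ne_top
  have hkey := integral_exp_intervalIntegral_congr
    (Y := fun u ω => visitIndicator X i (s + u) ω) (Y' := visitIndicator X i)
    (hmeas.comp (g := fun z : ℝ × Ω => visitIndicator X i z.1 z.2)
      (f := fun z : ℝ × Ω => (s + z.1, z.2)) (by fun_prop))
    (fun _ _ => visitIndicator_mem_Icc _ _ _ _) hmeas
    (fun _ _ => visitIndicator_mem_Icc _ _ _ _)
    (P.restrict {ω | X s.toNNReal ω = i}) (ENNReal.ofReal (p s.toNNReal i i) • P)
    (sub_nonneg.2 hst) ?_ κ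
  · rw [integral_smul_measure, ENNReal.toReal_ofReal (hp.nonneg _ _ _), smul_eq_mul,
      ← integral_indicator hA] at hkey
    rw [← hkey]
    refine integral_congr_ae (.of_forall fun ω => ?_)
    have hshift := intervalIntegral.integral_comp_add_left (a := 0) (b := t - s)
      (fun u => visitIndicator X i u ω) s
    rw [add_zero, add_sub_cancel] at hshift
    beta_reduce
    rw [← hshift]
    by_cases hω : X s.toNNReal ω = i <;> simp [visitIndicator, hω]
  · intro n u hu
    simp only [prod_visitIndicator]
    have h1 := hX.measurableSet_forall_eq (fun k => (s + u k).toNNReal)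
    rw [integral_indicator_one h1, integral_indicator_one (hX.measurableSet_forall_eq _),
      measureReal_def, measureReal_def, Measure.restrict_apply h1, Measure.smul_apply]
    simp only [Real.toNNReal_add hs (hu _)]
    rw [hX.measure_forall_eq_add hp, smul_eq_mul]

/-- The renewal equation for the exponential moment of the local time. -/
lemma renewal_equation [IsProbabilityMeasure P] (hX : IsMarkovProcess P X p i)
    (hp : IsTransitionFunction p) (κ : ℝ) {t : ℝ} (ht : 0 ≤ t) :
    ∫ ω, Real.exp (κ * localTime X i t.toNNReal ω) ∂P =
      1 + ∫ s in (0 : ℝ)..t, κ * p s.toNNReal i i *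
        ∫ ω, Real.exp (κ * localTime X i (t - s).toNNReal ω) ∂P := by
  have hmeas := hX.measurable_visitIndicator
  have hIcc := visitIndicator_mem_Icc X i
  simp only [localTime_eq, Real.coe_toNNReal _ ht]
  have hexp (ω : Ω) := exp_mul_integral_eq (g := fun s => visitIndicator X i s ω)
    (hmeas.comp (g := fun z : ℝ × Ω => visitIndicator X i z.1 z.2)
      (f := fun s : ℝ => (s, ω)) (by fun_prop)) (fun s => hIcc s ω) κ t
  -- Continuity in the time variable and measurability in `ω` give joint measurability, which Fubini
  -- requires below.
  have hjoint : Measurable fun z : ℝ × Ω => ∫ u in z.1..t, visitIndicator X i u z.2 := by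
    refine measurable_uncurry_of_continuous_of_measurable
      (u := fun s ω => ∫ u in s..t, visitIndicator X i u ω) (fun ω => ?_)
      (fun s => measurable_intervalIntegral_of_uncurry hmeas s t)
    simp only [intervalIntegral.integral_symm t]
    exact (intervalIntegral.continuous_primitive (intervalIntegrable_of_mem_Icc
      (hmeas.comp (g := fun z : ℝ × Ω => visitIndicator X i z.1 z.2)
        (f := fun s : ℝ => (s, ω)) (by fun_prop)) (fun s => hIcc s ω)) t).neg
  have hint : Integrable (Function.uncurry fun (s : ℝ) (ω : Ω) => visitIndicator X i s ω *
      Real.exp (κ * ∫ u in s..t, visitIndicator X i u ω))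
      ((volume.restrict (uIoc 0 t)).prod P) := by
    rw [uIoc_of_le ht]
    refine Integrable.of_bound (C := Real.exp (|κ| * t)) ?_ ?_
    · exact (hmeas.mul (Real.measurable_exp.comp (hjoint.const_mul κ))).aestronglyMeasurable
    · have hae : ∀ᵐ z ∂((volume.restrict (Ioc 0 t)).prod P), z.1 ∈ Ioc 0 t :=
        Measure.quasiMeasurePreserving_fst.ae (ae_restrict_mem measurableSet_Ioc)
      filter_upwards [hae] with z hz
      rw [Function.uncurry, norm_mul, Real.norm_of_nonneg (hIcc _ _).1, Real.norm_of_nonneg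
        (Real.exp_pos _).le]
      refine (mul_le_of_le_one_left (Real.exp_pos _).le (hIcc _ _).2).trans ?_
      refine Real.exp_le_exp.2 ((le_abs_self _).trans ?_)
      rw [abs_mul]
      gcongr
      refine (abs_intervalIntegral_le_of_mem_Icc (fun s => hIcc s _) _ _).trans ?_
      rw [abs_of_nonneg (by linarith [hz.2])]
      linarith [hz.1]
  calc ∫ ω, Real.exp (κ * ∫ u in (0 : ℝ)..t, visitIndicator X i u ω) ∂P
      = ∫ ω, (1 + κ * ∫ s in (0 : ℝ)..t, visitIndicator X i s ω *
          Real.exp (κ * ∫ u in s..t, visitIndicator X i u ω)) ∂P := by simp only [hexp]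
    _ = 1 + κ * ∫ s in (0 : ℝ)..t, ∫ ω, visitIndicator X i s ω *
          Real.exp (κ * ∫ u in s..t, visitIndicator X i u ω) ∂P := by
        rw [integral_add (integrable_const _), integral_const_mul,
          ← intervalIntegral_integral_swap hint]
        · simp
        · refine Integrable.const_mul ?_ κ
          have := hint.swap.integral_prod_left
          simpa only [Function.comp_apply, Prod.swap, Function.uncurry, uIoc_of_le ht,
            ← intervalIntegral.integral_of_le ht] using this
    _ = _ := by
        rw [← intervalIntegral.integral_const_mul]
        congr 1
        refine intervalIntegral.integral_congr fun s hs => ?_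
        rw [uIcc_of_le ht] at hs
        rw [hX.integral_visitIndicator_mul_exp hp κ hs.1 hs.2,
          Real.coe_toNNReal _ (by linarith [hs.2])]
        ring

end IsMarkovProcess

end MarkovProcess

/-! ### Renewal equation and Laplace transform -/

section Renewal

open Set

/-- One minus the Laplace transform of a probability density `φ` on the positive half-line. -/
noncomputable def laplaceDefect (φ : ℝ → ℝ) (s : ℝ) : ℝ :=
  ∫ t in Ioi (0 : ℝ), (1 - Real.exp (-(s * t))) * φ t

lemma integrableOn_exp_neg_mul_mul {φ : ℝ → ℝ} (hi : IntegrableOn φ (Ioi 0)) {s : ℝ} (hs : 0 ≤ s) :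
    IntegrableOn (fun t => Real.exp (-(s * t)) * φ t) (Ioi 0) := by
  refine Integrable.bdd_mul (c := 1) hi (by fun_prop) ?_
  filter_upwards [ae_restrict_mem measurableSet_Ioi] with t ht
  rw [Real.norm_of_nonneg (Real.exp_pos _).le, Real.exp_le_one_iff, neg_nonpos]
  exact mul_nonneg hs (le_of_lt ht)

lemma integral_exp_neg_mul_mul {φ : ℝ → ℝ} (hi : IntegrableOn φ (Ioi 0))
    (h1 : ∫ t in Ioi (0 : ℝ), φ t = 1) {s : ℝ} (hs : 0 ≤ s) :
    ∫ t in Ioi (0 : ℝ), Real.exp (-(s * t)) * φ t = 1 - laplaceDefect φ s := by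
  simp only [laplaceDefect, sub_mul, one_mul]
  rw [integral_sub hi (integrableOn_exp_neg_mul_mul hi hs), h1]
  ring

lemma laplaceDefect_pos {φ : ℝ → ℝ} (hnn : ∀ t, 0 ≤ φ t) (hi : IntegrableOn φ (Ioi 0))
    (h1 : ∫ t in Ioi (0 : ℝ), φ t = 1) {s : ℝ} (hs : 0 < s) : 0 < laplaceDefect φ s := by
  have hpos : ∀ t ∈ Ioi (0 : ℝ), 0 < 1 - Real.exp (-(s * t)) := fun t ht => by
    rw [sub_pos, Real.exp_lt_one_iff, neg_lt_zero]
    exact mul_pos hs ht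
  have hnn' : 0 ≤ᵐ[volume.restrict (Ioi 0)] fun t => (1 - Real.exp (-(s * t))) * φ t := by
    filter_upwards [ae_restrict_mem measurableSet_Ioi] with t ht
    exact mul_nonneg (hpos t ht).le (hnn t)
  have hint : IntegrableOn (fun t => (1 - Real.exp (-(s * t))) * φ t) (Ioi 0) := by
    simp only [sub_mul, one_mul]
    exact hi.sub (integrableOn_exp_neg_mul_mul hi hs.le)
  refine lt_of_le_of_ne (integral_nonneg_of_ae hnn') fun h0 => ?_
  have h2 := (integral_eq_zero_iff_of_nonneg_ae hnn' hint).1 h0.symm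
  have h3 : φ =ᵐ[volume.restrict (Ioi 0)] 0 := by
    filter_upwards [h2, ae_restrict_mem measurableSet_Ioi] with t ht ht'
    simpa [(hpos t ht').ne'] using ht
  rw [integral_congr_ae h3] at h1
  simp at h1

/-- `M` solves the renewal equation with inter-arrival density `φ`. -/
structure IsRenewalFunction (φ M : ℝ → ℝ) : Prop where
  density_nonneg : ∀ t, 0 ≤ φ t
  density_integrable : IntegrableOn φ (Ioi 0)
  density_integral : ∫ t in Ioi (0 : ℝ), φ t = 1
  monotone : Monotone M
  pos : ∀ t, 0 < M t
  renewal : ∀ t, 0 ≤ t → M t = 1 + ∫ s in (0 : ℝ)..t, φ s * M (t - s)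

namespace IsRenewalFunction

variable {φ M : ℝ → ℝ}

/-- Let `B` be the supremum of `e^{-su} M u` over `[0, t]`, finite by monotonicity. Multiplying the
renewal equation by `e^{-su}` gives `B ≤ 1 + B (1 - D s)`. The resulting bound is free of `t`, so
`M` grows more slowly than every exponential. -/
lemma exp_neg_mul_mul_le (h : IsRenewalFunction φ M) {s : ℝ} (hs : 0 < s) {t : ℝ} (ht : 0 ≤ t) :
    Real.exp (-(s * t)) * M t ≤ 1 / laplaceDefect φ s := by
  have hD := laplaceDefect_pos h.density_nonneg h.density_integrable h.density_integral hs
  set A := (fun u => Real.exp (-(s * u)) * M u) '' Icc 0 t with hA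
  have hexp : ∀ u, 0 ≤ u → Real.exp (-(s * u)) ≤ 1 := fun u hu => by
    rw [Real.exp_le_one_iff, neg_nonpos]; positivity
  have hbdd : BddAbove A := by
    refine ⟨M t, ?_⟩
    rintro _ ⟨u, hu, rfl⟩
    exact (mul_le_of_le_one_left (h.pos _).le (hexp u hu.1)).trans (h.monotone hu.2)
  set B := sSup A with hB
  have hle : ∀ u ∈ Icc 0 t, Real.exp (-(s * u)) * M u ≤ B := fun u hu =>
    le_csSup hbdd ⟨u, hu, rfl⟩
  have hB0 : 0 ≤ B := (mul_pos (Real.exp_pos _) (h.pos _)).le.trans (hle t ⟨ht, le_rfl⟩)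
  have hlap := integrableOn_exp_neg_mul_mul h.density_integrable hs.le
  have key : B ≤ 1 + B * (1 - laplaceDefect φ s) := by
    refine csSup_le ⟨_, ⟨t, ⟨ht, le_rfl⟩, rfl⟩⟩ ?_
    rintro _ ⟨u, hu, rfl⟩
    simp only
    rw [h.renewal u hu.1, mul_add, mul_one, ← intervalIntegral.integral_const_mul]
    refine add_le_add (hexp u hu.1) ?_
    rw [← integral_exp_neg_mul_mul h.density_integrable h.density_integral hs.le,
      ← integral_const_mul, intervalIntegral.integral_of_le hu.1]
    calc ∫ v in Ioc 0 u, Real.exp (-(s * u)) * (φ v * M (u - v))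
        ≤ ∫ v in Ioc 0 u, B * (Real.exp (-(s * v)) * φ v) := by
          refine integral_mono_of_nonneg ?_ ((hlap.mono_set Ioc_subset_Ioi_self).const_mul B) ?_
          · exact .of_forall fun v => mul_nonneg (Real.exp_pos _).le
              (mul_nonneg (h.density_nonneg _) (h.pos _).le)
          · filter_upwards [ae_restrict_mem measurableSet_Ioc] with v hv
            have h1 := hle (u - v) ⟨sub_nonneg.2 hv.2, by linarith [hv.1, hu.2]⟩
            calc Real.exp (-(s * u)) * (φ v * M (u - v))
                = (Real.exp (-(s * v)) * φ v) * (Real.exp (-(s * (u - v))) * M (u - v)) := by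
                  rw [show -(s * u) = -(s * v) + -(s * (u - v)) by ring, Real.exp_add]; ring
              _ ≤ (Real.exp (-(s * v)) * φ v) * B :=
                  mul_le_mul_of_nonneg_left h1
                    (mul_nonneg (Real.exp_pos _).le (h.density_nonneg _))
              _ = _ := mul_comm _ _
      _ ≤ ∫ v in Ioi 0, B * (Real.exp (-(s * v)) * φ v) :=
          setIntegral_mono_set (hlap.const_mul B)
            (.of_forall fun v => mul_nonneg hB0
              (mul_nonneg (Real.exp_pos _).le (h.density_nonneg _)))
            Ioc_subset_Ioi_self.eventuallyLE
  refine (hle t ⟨ht, le_rfl⟩).trans ?_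
  rw [le_div_iff₀ hD]
  linarith

lemma integrableOn_exp_neg_mul_mul (h : IsRenewalFunction φ M) {s : ℝ} (hs : 0 < s) :
    IntegrableOn (fun t => Real.exp (-(s * t)) * M t) (Ioi 0) := by
  -- The growth bound at `s / 2` leaves a spare integrable factor `e^{-st/2}`.
  have h2 : 0 < s / 2 := by positivity
  refine Integrable.mono' ((exp_neg_integrableOn_Ioi 0 h2).const_mul (1 / laplaceDefect φ (s / 2)))
    ?_ ?_
  · exact ((by fun_prop : Measurable fun t : ℝ => Real.exp (-(s * t))).mul
      h.monotone.measurable).aestronglyMeasurable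
  · filter_upwards [ae_restrict_mem measurableSet_Ioi] with t ht
    rw [Real.norm_of_nonneg (mul_pos (Real.exp_pos _) (h.pos _)).le,
      show -(s * t) = -(s / 2) * t + -(s / 2 * t) by ring, Real.exp_add, mul_assoc, mul_comm]
    exact mul_le_mul_of_nonneg_right (h.exp_neg_mul_mul_le h2 (le_of_lt ht)) (Real.exp_pos _).le

/-- The weight `e^{-sx}` factors through the convolution, so integrating the renewal equation yields
`M̂ - 1/s = (1 - D s) M̂`. -/
lemma mul_laplace_eq (h : IsRenewalFunction φ M) {s : ℝ} (hs : 0 < s) :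
    s * ∫ t in Ioi (0 : ℝ), Real.exp (-(s * t)) * M t = 1 / laplaceDefect φ s := by
  have hD := laplaceDefect_pos h.density_nonneg h.density_integrable h.density_integral hs
  have hM := h.integrableOn_exp_neg_mul_mul hs
  have hφ := CriticalLocalTime.integrableOn_exp_neg_mul_mul h.density_integrable hs.le
  have hexp : IntegrableOn (fun t => Real.exp (-(s * t))) (Ioi 0) := by
    simpa only [neg_mul] using exp_neg_integrableOn_Ioi 0 hs
  have hconv := integral_posConvolution hφ hM (ContinuousLinearMap.mul ℝ ℝ)
  simp only [ContinuousLinearMap.mul_apply'] at hconv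
  rw [integral_exp_neg_mul_mul h.density_integrable h.density_integral hs.le] at hconv
  have hdecomp : EqOn (fun x => ∫ t in (0 : ℝ)..x, Real.exp (-(s * t)) * φ t *
      (Real.exp (-(s * (x - t))) * M (x - t)))
      (fun x => Real.exp (-(s * x)) * M x - Real.exp (-(s * x))) (Ioi 0) := by
    intro x hx
    simp only
    rw [h.renewal x (le_of_lt hx), mul_add, mul_one, add_sub_cancel_left,
      ← intervalIntegral.integral_const_mul]
    refine intervalIntegral.integral_congr fun t _ => ?_
    rw [show -(s * x) = -(s * t) + -(s * (x - t)) by ring, Real.exp_add]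
    ring
  rw [setIntegral_congr_fun measurableSet_Ioi hdecomp, integral_sub hM hexp] at hconv
  have hone : ∫ t in Ioi (0 : ℝ), Real.exp (-(s * t)) = 1 / s := by
    have := integral_exp_mul_Ioi (a := -s) (by linarith) 0
    simpa [neg_mul, neg_div_neg_eq] using this
  rw [hone] at hconv
  rw [eq_div_iff hD.ne']
  have : s * (1 / s) = 1 := by field_simp
  linear_combination s * hconv + this

end IsRenewalFunction

end Renewal

/-! ### Karamata's Tauberian theorem -/

section Tauberian

open Set Topology

/-- The Laplace transform of `N` weighted by a test function `h` of the exponential. -/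
noncomputable def weightedLaplace (N h : ℝ → ℝ) (s : ℝ) : ℝ :=
  ∫ t in Ioi (0 : ℝ), h (Real.exp (-(s * t))) * (Real.exp (-(s * t)) * N t)

lemma exp_neg_mul_mem_Icc {s t : ℝ} (hs : 0 < s) (ht : t ∈ Ioi (0 : ℝ)) :
    Real.exp (-(s * t)) ∈ Icc (0 : ℝ) 1 := by
  refine ⟨(Real.exp_pos _).le, ?_⟩
  rw [Real.exp_le_one_iff, neg_nonpos]
  exact (mul_pos hs ht).le

lemma integrableOn_weightedLaplace {N h : ℝ → ℝ} (hh : Continuous h) {s : ℝ} (hs : 0 < s)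
    (hN : IntegrableOn (fun t => Real.exp (-(s * t)) * N t) (Ioi 0)) :
    IntegrableOn (fun t => h (Real.exp (-(s * t))) * (Real.exp (-(s * t)) * N t)) (Ioi 0) := by
  obtain ⟨C, hC⟩ := (isCompact_Icc (a := (0 : ℝ)) (b := 1)).exists_bound_of_continuousOn
    hh.continuousOn
  refine Integrable.bdd_mul (c := C) hN (by fun_prop) ?_
  filter_upwards [ae_restrict_mem measurableSet_Ioi] with t ht
  exact hC _ (exp_neg_mul_mem_Icc hs ht)

lemma weightedLaplace_add {N h k : ℝ → ℝ} (hh : Continuous h) (hk : Continuous k) {s : ℝ}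
    (hs : 0 < s) (hN : IntegrableOn (fun t => Real.exp (-(s * t)) * N t) (Ioi 0)) :
    weightedLaplace N (fun v => h v + k v) s = weightedLaplace N h s + weightedLaplace N k s := by
  simp only [weightedLaplace, add_mul]
  exact integral_add (integrableOn_weightedLaplace hh hs hN) (integrableOn_weightedLaplace hk hs hN)

lemma weightedLaplace_monomial (N : ℝ → ℝ) (c : ℝ) (n : ℕ) (s : ℝ) :
    weightedLaplace N (fun v => c * v ^ n) s =
      c * ∫ t in Ioi (0 : ℝ), Real.exp (-((n + 1) * s * t)) * N t := by
  rw [weightedLaplace, ← integral_const_mul]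
  congr 1 with t
  rw [← Real.exp_nat_mul, mul_assoc, ← mul_assoc (Real.exp _) (Real.exp _), ← Real.exp_add]
  ring_nf

lemma weightedLaplace_mono {N N' h h' : ℝ → ℝ} (hh : Continuous h) (hh' : Continuous h') {s : ℝ}
    (hs : 0 < s) (hN : IntegrableOn (fun t => Real.exp (-(s * t)) * N t) (Ioi 0))
    (hN' : IntegrableOn (fun t => Real.exp (-(s * t)) * N' t) (Ioi 0))
    (hle : ∀ t, 0 < t →
      h (Real.exp (-(s * t))) * N t ≤ h' (Real.exp (-(s * t))) * N' t) :
    weightedLaplace N h s ≤ weightedLaplace N' h' s := by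
  refine setIntegral_mono_on (integrableOn_weightedLaplace hh hs hN)
    (integrableOn_weightedLaplace hh' hs hN') measurableSet_Ioi fun t ht => ?_
  rw [mul_left_comm, mul_left_comm (h' _)]
  exact mul_le_mul_of_nonneg_left (hle t ht) (Real.exp_pos _).le

lemma abs_weightedLaplace_sub_le {N h k : ℝ → ℝ} (hh : Continuous h) (hk : Continuous k) {s : ℝ}
    (hs : 0 < s) (hN : IntegrableOn (fun t => Real.exp (-(s * t)) * N t) (Ioi 0))
    (hnn : ∀ t, 0 < t → 0 ≤ N t) {ε : ℝ} (hε : ∀ v ∈ Icc (0 : ℝ) 1, |k v - h v| ≤ ε) :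
    |weightedLaplace N k s - weightedLaplace N h s| ≤
      ε * ∫ t in Ioi (0 : ℝ), Real.exp (-(s * t)) * N t := by
  rw [weightedLaplace, weightedLaplace, ← integral_sub (integrableOn_weightedLaplace hk hs hN)
    (integrableOn_weightedLaplace hh hs hN), ← integral_const_mul, ← Real.norm_eq_abs]
  refine norm_integral_le_of_norm_le (hN.const_mul ε) ?_
  filter_upwards [ae_restrict_mem measurableSet_Ioi] with t ht
  have h0 : 0 ≤ Real.exp (-(s * t)) * N t := mul_nonneg (Real.exp_pos _).le (hnn t ht)
  rw [← sub_mul, norm_mul, Real.norm_of_nonneg h0]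
  exact mul_le_mul_of_nonneg_right (hε _ (exp_neg_mul_mem_Icc hs ht)) h0

lemma integrableOn_exp_neg_mul_rpow {ρ : ℝ} (hρ : 0 ≤ ρ) {s : ℝ} (hs : 0 < s) :
    IntegrableOn (fun t => Real.exp (-(s * t)) * t ^ ρ) (Ioi 0) := by
  have := integrableOn_rpow_mul_exp_neg_mul_rpow (s := ρ) (p := 1) (by linarith) one_pos hs
  simpa only [Real.rpow_one, mul_comm, neg_mul, mul_neg] using this

lemma integral_exp_neg_mul_rpow {ρ : ℝ} (hρ : 0 ≤ ρ) {s : ℝ} (hs : 0 < s) :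
    ∫ t in Ioi (0 : ℝ), Real.exp (-(s * t)) * t ^ ρ = (1 / s) ^ (ρ + 1) * Real.Gamma (ρ + 1) := by
  rw [← Real.integral_rpow_mul_exp_neg_mul_Ioi (by linarith) hs]
  simp only [add_sub_cancel_right, mul_comm]

variable {M A : ℝ → ℝ} {ρ : ℝ}

/-- Weighting by `v ^ n` at `v = e^{-st}` only replaces `s` by `(n+1) s`, so for monomials the claim
is exactly the regular variation `hreg`; linearity does the rest. -/
lemma tendsto_weightedLaplace_polynomial
    (hM : ∀ s, 0 < s → IntegrableOn (fun t => Real.exp (-(s * t)) * M t) (Ioi 0))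
    (hA : ∀ s, 0 < s → s * ∫ t in Ioi (0 : ℝ), Real.exp (-(s * t)) * M t = A s)
    (hρ : 0 ≤ ρ)
    (hreg : ∀ n : ℕ, Tendsto (fun s => A ((n + 1) * s) / A s) (𝓝[>] 0) (𝓝 ((n + 1 : ℝ) ^ (-ρ))))
    (q : Polynomial ℝ) :
    Tendsto (fun s => s * weightedLaplace M (fun v => q.eval v) s / A s) (𝓝[>] 0)
      (𝓝 (weightedLaplace (fun u => u ^ ρ) (fun v => q.eval v) 1 / Real.Gamma (ρ + 1))) := by
  induction q using Polynomial.induction_on' with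
  | add q r hq hr =>
    simp only [Polynomial.eval_add]
    rw [weightedLaplace_add q.continuous r.continuous one_pos
      (integrableOn_exp_neg_mul_rpow hρ one_pos), add_div]
    refine (hq.add hr).congr' ?_
    filter_upwards [self_mem_nhdsWithin] with s hs
    rw [weightedLaplace_add q.continuous r.continuous hs (hM s hs)]
    ring
  | monomial n c =>
    simp only [Polynomial.eval_monomial, weightedLaplace_monomial]
    have hn : (0 : ℝ) < n + 1 := by positivity
    have hG := (Real.Gamma_pos_of_pos (by linarith : 0 < ρ + 1)).ne'
    rw [mul_one, integral_exp_neg_mul_rpow hρ hn, one_div, Real.inv_rpow hn.le,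
      ← Real.rpow_neg hn.le, show -(ρ + 1) = -ρ - 1 by ring, Real.rpow_sub_one hn.ne']
    have := (hreg n).const_mul (c / (n + 1))
    refine (this.congr' ?_).trans_eq ?_
    · filter_upwards [self_mem_nhdsWithin] with s hs
      rw [← hA _ (mul_pos hn hs)]
      field_simp
    · congr 1
      field_simp

/-- Weierstrass approximation on `[0, 1]`, where `e^{-st}` lives. The error is uniform in `s`
because the measure `s e^{-st} M t dt / A s` has total mass one. -/
lemma tendsto_weightedLaplace (hnn : ∀ t, 0 ≤ M t) (hApos : ∀ s, 0 < s → 0 < A s)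
    (hM : ∀ s, 0 < s → IntegrableOn (fun t => Real.exp (-(s * t)) * M t) (Ioi 0))
    (hA : ∀ s, 0 < s → s * ∫ t in Ioi (0 : ℝ), Real.exp (-(s * t)) * M t = A s)
    (hρ : 0 ≤ ρ)
    (hreg : ∀ n : ℕ, Tendsto (fun s => A ((n + 1) * s) / A s) (𝓝[>] 0) (𝓝 ((n + 1 : ℝ) ^ (-ρ))))
    {h : ℝ → ℝ} (hh : Continuous h) :
    Tendsto (fun s => s * weightedLaplace M h s / A s) (𝓝[>] 0)
      (𝓝 (weightedLaplace (fun u => u ^ ρ) h 1 / Real.Gamma (ρ + 1))) := by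
  have hG := Real.Gamma_pos_of_pos (by linarith : 0 < ρ + 1)
  rw [Metric.tendsto_nhds]
  intro ε hε
  obtain ⟨q, hq⟩ := exists_polynomial_near_of_continuousOn 0 1 h hh.continuousOn (ε / 3)
    (by positivity)
  have hlim : |weightedLaplace (fun u => u ^ ρ) (fun v => q.eval v) 1 / Real.Gamma (ρ + 1) -
      weightedLaplace (fun u => u ^ ρ) h 1 / Real.Gamma (ρ + 1)| ≤ ε / 3 := by
    rw [← sub_div, abs_div, abs_of_pos hG, div_le_iff₀ hG]
    have := abs_weightedLaplace_sub_le (N := fun u => u ^ ρ) hh q.continuous one_pos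
      (integrableOn_exp_neg_mul_rpow hρ one_pos) (fun t ht => Real.rpow_nonneg ht.le _)
      (fun v hv => (hq v hv).le)
    rwa [integral_exp_neg_mul_rpow hρ one_pos, div_one, Real.one_rpow, one_mul] at this
  filter_upwards [self_mem_nhdsWithin, (Metric.tendsto_nhds.1
    (tendsto_weightedLaplace_polynomial hM hA hρ hreg q)) (ε / 3) (by positivity)] with s hs h1
  have h2 : |s * weightedLaplace M (fun v => q.eval v) s / A s - s * weightedLaplace M h s / A s|
      ≤ ε / 3 := by
    rw [← sub_div, ← mul_sub, abs_div, abs_mul, abs_of_pos (hApos s hs), abs_of_pos hs,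
      div_le_iff₀ (hApos s hs), ← hA s hs, mul_left_comm]
    exact mul_le_mul_of_nonneg_left (abs_weightedLaplace_sub_le hh q.continuous hs (hM s hs)
      (fun t _ => hnn t) (fun v hv => (hq v hv).le)) (le_of_lt hs)
  rw [Real.dist_eq] at h1 ⊢
  rw [abs_le] at hlim h2
  rw [abs_lt] at h1 ⊢
  constructor <;> linarith [hlim.1, hlim.2, h1.1, h1.2, h2.1, h2.2]

/-- A continuous bump such that `u ↦ bump a b (exp (-u))` is supported on `[a, b]`. -/
noncomputable def expBump (a b v : ℝ) : ℝ := max 0 ((v - Real.exp (-b)) * (Real.exp (-a) - v))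

lemma continuous_expBump (a b : ℝ) : Continuous (expBump a b) := by
  unfold expBump; fun_prop

lemma expBump_nonneg (a b v : ℝ) : 0 ≤ expBump a b v := le_max_left _ _

lemma expBump_exp_pos_iff {a b : ℝ} (hab : a < b) (u : ℝ) :
    0 < expBump a b (Real.exp (-u)) ↔ u ∈ Ioo a b := by
  have hexp : Real.exp (-b) < Real.exp (-a) := Real.exp_lt_exp.2 (by linarith)
  have h1 : 0 < Real.exp (-u) - Real.exp (-b) ↔ u < b := by simp
  have h2 : 0 < Real.exp (-a) - Real.exp (-u) ↔ a < u := by simp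
  rw [expBump, lt_max_iff, mul_pos_iff, h1, h2]
  constructor
  · rintro (h | ⟨h, h'⟩ | ⟨h, h'⟩)
    · exact absurd h (lt_irrefl _)
    · exact ⟨h', h⟩
    · linarith
  · exact fun h => Or.inr (Or.inl ⟨h.2, h.1⟩)

lemma integrableOn_exp_neg_mul_one {s : ℝ} (hs : 0 < s) :
    IntegrableOn (fun t => Real.exp (-(s * t)) * (1 : ℝ)) (Ioi 0) := by
  simpa using integrableOn_exp_neg_mul_rpow le_rfl hs

lemma mul_weightedLaplace_one (h : ℝ → ℝ) {s : ℝ} (hs : 0 < s) :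
    s * weightedLaplace (fun _ => 1) h s = weightedLaplace (fun _ => 1) h 1 := by
  have := integral_comp_mul_left_Ioi
    (fun u => h (Real.exp (-u)) * (Real.exp (-u) * 1)) 0 hs
  rw [mul_zero, smul_eq_mul] at this
  simp only [weightedLaplace, one_mul]
  rw [this, mul_inv_cancel_left₀ hs.ne']

lemma weightedLaplace_expBump_pos {a b : ℝ} (ha : 0 ≤ a) (hab : a < b) :
    0 < weightedLaplace (fun _ => 1) (expBump a b) 1 := by
  rw [weightedLaplace, setIntegral_pos_iff_support_of_nonneg_ae]
  · refine lt_of_lt_of_le ?_ (measure_mono (s := Ioo a b) ?_)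
    · simpa using hab
    · intro u hu
      refine ⟨?_, ha.trans_lt hu.1⟩
      have := (expBump_exp_pos_iff hab u).2 hu
      simp [this.ne']
  · exact .of_forall fun u => mul_nonneg (expBump_nonneg _ _ _) (by positivity)
  · exact integrableOn_weightedLaplace (continuous_expBump a b) one_pos
      (integrableOn_exp_neg_mul_one one_pos)

/-- The bump sees `N` only where `s t ∈ (a, b)`, and by scaling its own mass does not depend on `s`.
-/
lemma weightedLaplace_expBump_le {N : ℝ → ℝ} {a b s m : ℝ} (hab : a < b) (hs : 0 < s)
    (hN : IntegrableOn (fun t => Real.exp (-(s * t)) * N t) (Ioi 0))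
    (hm : ∀ t, s * t ∈ Ioo a b → N t ≤ m) :
    s * weightedLaplace N (expBump a b) s ≤ m * weightedLaplace (fun _ => 1) (expBump a b) 1 := by
  rw [← mul_weightedLaplace_one _ hs, mul_left_comm]
  refine mul_le_mul_of_nonneg_left ?_ hs.le
  have hc := continuous_expBump a b
  have : m * weightedLaplace (fun _ => 1) (expBump a b) s =
      weightedLaplace (fun _ => m) (expBump a b) s := by
    simp only [weightedLaplace, ← integral_const_mul]
    congr 1 with t; ring
  rw [this]
  refine weightedLaplace_mono hc hc hs hN
    (by simpa [IntegrableOn] using (integrableOn_exp_neg_mul_one hs).mul_const m) fun t _ => ?_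
  rcases (expBump_nonneg a b (Real.exp (-(s * t)))).eq_or_lt with h0 | h0
  · simp [← h0]
  · exact mul_le_mul_of_nonneg_left (hm t ((expBump_exp_pos_iff hab _).1 h0)) h0.le

lemma le_weightedLaplace_expBump {N : ℝ → ℝ} {a b s m : ℝ} (hab : a < b) (hs : 0 < s)
    (hN : IntegrableOn (fun t => Real.exp (-(s * t)) * N t) (Ioi 0))
    (hm : ∀ t, s * t ∈ Ioo a b → m ≤ N t) :
    m * weightedLaplace (fun _ => 1) (expBump a b) 1 ≤ s * weightedLaplace N (expBump a b) s := by
  have := weightedLaplace_expBump_le (N := fun t => -N t) (m := -m) hab hs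
    (by simpa using hN.neg) (fun t ht => neg_le_neg (hm t ht))
  have hneg : weightedLaplace (fun t => -N t) (expBump a b) s =
      -weightedLaplace N (expBump a b) s := by
    simp only [weightedLaplace, ← integral_neg]
    congr 1 with t; ring
  rw [hneg] at this
  linarith

/-- **Karamata's Tauberian theorem** for monotone functions. -/
theorem tendsto_div_of_laplace_regularlyVarying (hmono : Monotone M) (hnn : ∀ t, 0 ≤ M t)
    (hApos : ∀ s, 0 < s → 0 < A s)
    (hM : ∀ s, 0 < s → IntegrableOn (fun t => Real.exp (-(s * t)) * M t) (Ioi 0))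
    (hA : ∀ s, 0 < s → s * ∫ t in Ioi (0 : ℝ), Real.exp (-(s * t)) * M t = A s)
    (hρ : 0 ≤ ρ)
    (hreg : ∀ n : ℕ, Tendsto (fun s => A ((n + 1) * s) / A s) (𝓝[>] 0) (𝓝 ((n + 1 : ℝ) ^ (-ρ)))) :
    Tendsto (fun t => M t / A t⁻¹) atTop (𝓝 (1 / Real.Gamma (ρ + 1))) := by
  have hG := Real.Gamma_pos_of_pos (by linarith : 0 < ρ + 1)
  suffices hmain : Tendsto (fun s => M s⁻¹ / A s) (𝓝[>] 0) (𝓝 (1 / Real.Gamma (ρ + 1))) by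
    have := hmain.comp tendsto_inv_atTop_nhdsGT_zero
    simpa only [Function.comp_def, inv_inv] using this
  have hcont : Tendsto (fun b : ℝ => b ^ ρ / Real.Gamma (ρ + 1)) (𝓝 1)
      (𝓝 (1 / Real.Gamma (ρ + 1))) := by
    have := ((Real.continuousAt_rpow_const 1 ρ (Or.inl one_ne_zero)).tendsto).div_const
      (Real.Gamma (ρ + 1))
    rwa [Real.one_rpow] at this
  have hrpow := integrableOn_exp_neg_mul_rpow hρ one_pos
  rw [tendsto_order]
  constructor
  -- Lower bound: on a bump over `[a, 1]`, `s t ≤ 1` gives `M t ≤ M s⁻¹`, while the limiting weight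
  -- `u ^ ρ` is at least `a ^ ρ`. Choosing `a` close to `1` brings `a ^ ρ / Γ(ρ+1)` above `c`.
  · intro c hc
    have hev := ((hcont.mono_left (nhdsWithin_le_nhds (s := Iio 1))).eventually_const_lt hc).and
      (Ioo_mem_nhdsLT (zero_lt_one (α := ℝ)))
    obtain ⟨a, hac, ha0, ha1⟩ := hev.exists
    have hI := weightedLaplace_expBump_pos ha0.le ha1
    have hlim := (tendsto_weightedLaplace hnn hApos hM hA hρ hreg
      (continuous_expBump a 1)).div_const (weightedLaplace (fun _ => 1) (expBump a 1) 1)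
    have hge := le_weightedLaplace_expBump (m := a ^ ρ) ha1 one_pos hrpow (fun t ht => by
      rw [one_mul] at ht
      exact Real.rpow_le_rpow ha0.le ht.1.le hρ)
    rw [one_mul] at hge
    have hclt : c < weightedLaplace (fun u => u ^ ρ) (expBump a 1) 1 / Real.Gamma (ρ + 1) /
        weightedLaplace (fun _ => 1) (expBump a 1) 1 := by
      refine hac.trans_le ?_
      rw [div_right_comm]
      gcongr
      rwa [le_div_iff₀ hI]
    filter_upwards [hlim.eventually_const_lt hclt, self_mem_nhdsWithin] with s h1 hs
    refine h1.trans_le ?_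
    rw [div_right_comm]
    refine div_le_div_of_nonneg_right ?_ (hApos s hs).le
    rw [div_le_iff₀ hI]
    refine weightedLaplace_expBump_le ha1 hs (hM s hs) fun t ht => hmono ?_
    rw [← one_div, le_div_iff₀' hs]
    exact ht.2.le
  -- Upper bound: the mirror argument with a bump over `[1, b]`, where `M t ≥ M s⁻¹` and `u ^ ρ ≤ b
  -- ^ ρ`.
  · intro c hc
    have hev := ((hcont.mono_left (nhdsWithin_le_nhds (s := Ioi 1))).eventually_lt_const hc).and
      self_mem_nhdsWithin
    obtain ⟨b, hbc, hb1⟩ := hev.exists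
    have hb1 : 1 < b := hb1
    have hI := weightedLaplace_expBump_pos zero_le_one hb1
    have hlim := (tendsto_weightedLaplace hnn hApos hM hA hρ hreg
      (continuous_expBump 1 b)).div_const (weightedLaplace (fun _ => 1) (expBump 1 b) 1)
    have hle := weightedLaplace_expBump_le (m := b ^ ρ) hb1 one_pos hrpow (fun t ht => by
      rw [one_mul] at ht
      exact Real.rpow_le_rpow (by linarith [ht.1]) ht.2.le hρ)
    rw [one_mul] at hle
    have hclt : weightedLaplace (fun u => u ^ ρ) (expBump 1 b) 1 / Real.Gamma (ρ + 1) /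
        weightedLaplace (fun _ => 1) (expBump 1 b) 1 < c := by
      refine lt_of_le_of_lt ?_ hbc
      rw [div_right_comm]
      gcongr
      rwa [div_le_iff₀ hI]
    filter_upwards [hlim.eventually_lt_const hclt, self_mem_nhdsWithin] with s h1 hs
    refine lt_of_le_of_lt ?_ h1
    rw [div_right_comm]
    refine div_le_div_of_nonneg_right ?_ (hApos s hs).le
    rw [le_div_iff₀ hI]
    refine le_weightedLaplace_expBump hb1 hs (hM s hs) fun t ht => hmono ?_
    rw [← one_div, div_le_iff₀' hs]
    exact ht.1.le

end Tauberian

/-! ### Behaviour of the Laplace defect at zero -/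

section LaplaceDefectAsymptotics

open Set Topology

lemma one_sub_exp_neg_nonneg {x : ℝ} (hx : 0 ≤ x) : 0 ≤ 1 - Real.exp (-x) := by
  rw [sub_nonneg, Real.exp_le_one_iff]
  linarith

lemma one_sub_exp_neg_le (x : ℝ) : 1 - Real.exp (-x) ≤ x := by
  linarith [Real.one_sub_le_exp_neg x]

lemma one_sub_exp_neg_le_one (x : ℝ) : 1 - Real.exp (-x) ≤ 1 := by
  linarith [Real.exp_pos (-x)]

lemma sub_sq_div_two_le_one_sub_exp_neg {x : ℝ} (hx : 0 ≤ x) :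
    x - x ^ 2 / 2 ≤ 1 - Real.exp (-x) := by
  have h1 := Real.quadratic_le_exp_of_nonneg hx
  have h2 : Real.exp (-x) * (1 + x + x ^ 2 / 2) ≤ 1 := by
    calc _ ≤ Real.exp (-x) * Real.exp x := by gcongr
      _ = 1 := by rw [← Real.exp_add]; simp
  -- The product equals `1 + x ^ 4 / 4`.
  have h3 : 1 ≤ (1 - x + x ^ 2 / 2) * (1 + x + x ^ 2 / 2) := by nlinarith [sq_nonneg (x ^ 2)]
  have h4 := le_of_mul_le_mul_right (h2.trans h3) (by positivity)
  linarith

/-- The integrand is at most `u^{1-α}` near `0` (integrable as `α < 2`) and at most `u^{-α}` at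
infinity (integrable as `α > 1`). -/
lemma integrableOn_one_sub_exp_neg_mul_rpow {α : ℝ} (h1 : 1 < α) (h2 : α < 2) :
    IntegrableOn (fun u => (1 - Real.exp (-u)) * u ^ (-α)) (Ioi 0) := by
  rw [← Ioc_union_Ioi_eq_Ioi zero_le_one]
  refine IntegrableOn.union ?_ ?_
  · have hi : IntegrableOn (fun u : ℝ => u ^ (1 - α)) (Ioc 0 1) := by
      rw [← intervalIntegrable_iff_integrableOn_Ioc_of_le zero_le_one]
      exact intervalIntegral.intervalIntegrable_rpow' (by linarith)
    refine Integrable.mono' hi (by fun_prop) ?_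
    filter_upwards [ae_restrict_mem measurableSet_Ioc] with u hu
    have h0 := one_sub_exp_neg_nonneg hu.1.le
    rw [Real.norm_of_nonneg (mul_nonneg h0 (Real.rpow_nonneg hu.1.le _)), sub_eq_add_neg 1 α,
      Real.rpow_add hu.1, Real.rpow_one]
    exact mul_le_mul_of_nonneg_right (one_sub_exp_neg_le u) (Real.rpow_nonneg hu.1.le _)
  · refine Integrable.mono' (integrableOn_Ioi_rpow_of_lt (a := -α) (by linarith) one_pos)
      (by fun_prop) ?_
    filter_upwards [ae_restrict_mem measurableSet_Ioi] with u hu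
    have hu0 : 0 < u := one_pos.trans hu
    rw [Real.norm_of_nonneg (mul_nonneg (one_sub_exp_neg_nonneg hu0.le)
      (Real.rpow_nonneg hu0.le _))]
    exact mul_le_of_le_one_left (Real.rpow_nonneg hu0.le _) (one_sub_exp_neg_le_one u)

/-- Integration by parts reduces it to the Gamma integral; the boundary terms are at most `u^{2-α} /
(α-1)` near `0` and `u^{1-α} / (α-1)` at infinity, so both vanish. -/
lemma integral_one_sub_exp_neg_mul_rpow {α : ℝ} (h1 : 1 < α) (h2 : α < 2) :
    ∫ u in Ioi (0 : ℝ), (1 - Real.exp (-u)) * u ^ (-α) = Real.Gamma (2 - α) / (α - 1) := by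
  have hne : 1 - α ≠ 0 := by linarith
  have hG : ∫ u in Ioi (0 : ℝ), Real.exp (-u) * u ^ (1 - α) = Real.Gamma (2 - α) := by
    rw [Real.Gamma_eq_integral (by linarith)]
    congr 1 with u
    ring_nf
  have hGi : IntegrableOn (fun u => Real.exp (-u) * u ^ (1 - α)) (Ioi 0) := by
    have := Real.GammaIntegral_convergent (s := 2 - α) (by linarith)
    rwa [show 2 - α - 1 = 1 - α by ring] at this
  have hparts := integral_Ioi_mul_deriv_eq_deriv_mul (a := 0) (a' := (0 : ℝ)) (b' := 0)
    (u := fun u => 1 - Real.exp (-u)) (v := fun u => u ^ (1 - α) / (1 - α))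
    (u' := fun u => Real.exp (-u)) (v' := fun u => u ^ (-α)) ?_ ?_
    (integrableOn_one_sub_exp_neg_mul_rpow h1 h2) ?_ ?_ ?_
  · rw [hparts]
    simp only [← mul_div_assoc]
    rw [integral_div, hG, ← neg_sub 1 α, div_neg]
    ring
  · intro x _
    have := ((hasDerivAt_id x).neg.exp).const_sub 1
    simpa using this
  · intro x hx
    have := (Real.hasDerivAt_rpow_const (p := 1 - α) (Or.inl (ne_of_gt hx))).div_const (1 - α)
    rw [mul_div_cancel_left₀ _ hne] at this
    simpa using this
  · simpa only [IntegrableOn, Pi.mul_def, ← mul_div_assoc] using hGi.div_const (1 - α)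
  · rw [tendsto_zero_iff_abs_tendsto_zero]
    have hlim : Tendsto (fun u : ℝ => u ^ (2 - α) / (α - 1)) (𝓝[>] 0) (𝓝 0) := by
      have := ((Real.continuousAt_rpow_const 0 (2 - α) (Or.inr (by linarith))).tendsto).div_const
        (α - 1)
      rw [Real.zero_rpow (by linarith), zero_div] at this
      exact this.mono_left nhdsWithin_le_nhds
    refine squeeze_zero' (.of_forall fun _ => abs_nonneg _) ?_ hlim
    filter_upwards [self_mem_nhdsWithin] with u hu
    have hu : 0 < u := hu
    have hp := Real.rpow_nonneg hu.le (1 - α)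
    rw [Function.comp_apply, Pi.mul_apply, abs_mul, abs_div,
      abs_of_nonneg (one_sub_exp_neg_nonneg hu.le), abs_of_nonneg hp, abs_sub_comm,
      abs_of_pos (by linarith : 0 < α - 1), ← mul_div_assoc,
      show 2 - α = 1 + (1 - α) by ring, Real.rpow_add hu, Real.rpow_one]
    have := one_sub_exp_neg_le u
    have : 0 < α - 1 := by linarith
    gcongr
  · rw [tendsto_zero_iff_abs_tendsto_zero]
    have hlim : Tendsto (fun u : ℝ => u ^ (-(α - 1)) / (α - 1)) atTop (𝓝 0) := by
      simpa using (tendsto_rpow_neg_atTop (by linarith : 0 < α - 1)).div_const (α - 1)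
    refine squeeze_zero' (.of_forall fun _ => abs_nonneg _) ?_ hlim
    filter_upwards [eventually_gt_atTop 0] with u hu
    have hp := Real.rpow_nonneg hu.le (1 - α)
    have h0 : 0 < α - 1 := by linarith
    rw [Function.comp_apply, Pi.mul_apply, abs_mul, abs_div,
      abs_of_nonneg (one_sub_exp_neg_nonneg hu.le), abs_of_nonneg hp, abs_sub_comm,
      abs_of_pos h0, neg_sub]
    exact mul_le_of_le_one_left (by positivity) (one_sub_exp_neg_le_one u)

variable {φ : ℝ → ℝ} {α B C : ℝ}

lemma exists_le_mul_rpow_neg (hnn : ∀ t, 0 ≤ φ t) (hB : ∀ t, φ t ≤ B) (hα : 0 ≤ α)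
    (hlim : Tendsto (fun t => φ t * t ^ α) atTop (𝓝 C)) :
    ∃ K, ∀ t, 0 < t → φ t * t ^ α ≤ K := by
  obtain ⟨T, hT⟩ := eventually_atTop.1 (hlim.eventually_lt_const (lt_add_one C))
  have hB0 : 0 ≤ B := (hnn 0).trans (hB 0)
  refine ⟨max (C + 1) (B * T ^ α), fun t ht => ?_⟩
  rcases le_total T t with h | h
  · exact (hT t h).le.trans (le_max_left _ _)
  · refine le_trans ?_ (le_max_right _ _)
    exact mul_le_mul (hB t) (Real.rpow_le_rpow ht.le h hα) (Real.rpow_nonneg ht.le _) hB0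

/-- Substituting `t = u / s` makes the quotient the integral of `φ(u/s) (u/s)^α` against `(1 -
e^{-u}) u^{-α}`. The first factor is bounded and tends to `C`, so dominated convergence applies. -/
lemma tendsto_laplaceDefect_div_rpow (hmeas : Measurable φ) (hnn : ∀ t, 0 ≤ φ t)
    (hB : ∀ t, φ t ≤ B) (h1 : 1 < α) (h2 : α < 2)
    (hlim : Tendsto (fun t => φ t * t ^ α) atTop (𝓝 C)) :
    Tendsto (fun s => laplaceDefect φ s / s ^ (α - 1)) (𝓝[>] 0)
      (𝓝 (C * (Real.Gamma (2 - α) / (α - 1)))) := by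
  obtain ⟨K, hK⟩ := exists_le_mul_rpow_neg hnn hB (by linarith) hlim
  have hint := integrableOn_one_sub_exp_neg_mul_rpow h1 h2
  rw [← integral_one_sub_exp_neg_mul_rpow h1 h2, ← integral_const_mul]
  have hconv : Tendsto (fun s : ℝ => ∫ u in Ioi (0 : ℝ), (φ (s⁻¹ * u) * (s⁻¹ * u) ^ α) *
      ((1 - Real.exp (-u)) * u ^ (-α))) (𝓝[>] 0)
      (𝓝 (∫ u in Ioi (0 : ℝ), C * ((1 - Real.exp (-u)) * u ^ (-α)))) := by
    refine tendsto_integral_filter_of_dominated_convergence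
      (fun u => K * ((1 - Real.exp (-u)) * u ^ (-α))) (.of_forall fun s => ?_) ?_
      (hint.const_mul K) ?_
    · have : Measurable fun u => φ (s⁻¹ * u) := hmeas.comp (by fun_prop)
      exact Measurable.aestronglyMeasurable (by fun_prop)
    · filter_upwards [self_mem_nhdsWithin] with s hs
      filter_upwards [ae_restrict_mem measurableSet_Ioi] with u hu
      have hsu : 0 < s⁻¹ * u := mul_pos (inv_pos.2 hs) hu
      have h0 : 0 ≤ (1 - Real.exp (-u)) * u ^ (-α) :=
        mul_nonneg (one_sub_exp_neg_nonneg (le_of_lt hu)) (Real.rpow_nonneg (le_of_lt hu) _)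
      rw [norm_mul, Real.norm_of_nonneg h0,
        Real.norm_of_nonneg (mul_nonneg (hnn _) (Real.rpow_nonneg hsu.le _))]
      exact mul_le_mul_of_nonneg_right (hK _ hsu) h0
    · filter_upwards [ae_restrict_mem measurableSet_Ioi] with u hu
      refine Tendsto.mul_const _ (hlim.comp ?_)
      exact tendsto_inv_nhdsGT_zero.atTop_mul_const hu
  refine hconv.congr' ?_
  filter_upwards [self_mem_nhdsWithin] with s hs
  have hs : 0 < s := hs
  have hsub := integral_comp_mul_left_Ioi (fun t => (1 - Real.exp (-(s * t))) * φ t) 0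
    (inv_pos.2 hs)
  rw [mul_zero, inv_inv, smul_eq_mul] at hsub
  rw [laplaceDefect, eq_div_iff (Real.rpow_pos_of_pos hs _).ne', ← mul_right_inj' hs.ne', ← hsub,
    ← integral_mul_const, ← integral_const_mul]
  refine setIntegral_congr_fun measurableSet_Ioi fun u hu => ?_
  have hu : 0 < u := hu
  have e1 : u ^ α * u ^ (-α) = 1 := by rw [← Real.rpow_add hu]; simp
  have e2 : s⁻¹ ^ α * (s * s ^ (α - 1)) = 1 := by
    rw [Real.rpow_sub_one hs.ne', mul_div_cancel₀ _ hs.ne', ← Real.mul_rpow (inv_pos.2 hs).le hs.le,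
      inv_mul_cancel₀ hs.ne', Real.one_rpow]
  rw [mul_inv_cancel_left₀ hs.ne', Real.mul_rpow (inv_pos.2 hs).le hu.le]
  linear_combination (1 - Real.exp (-u)) * φ (s⁻¹ * u) *
    ((s⁻¹ ^ α * (s * s ^ (α - 1))) * e1 + e2)

/-- `(1 - e^{-st}) / s` tends to `t` and is dominated by `t`. -/
lemma tendsto_laplaceDefect_div (hnn : ∀ t, 0 ≤ φ t)
    (hint : IntegrableOn (fun t => t * φ t) (Ioi 0)) (hmeas : Measurable φ) :
    Tendsto (fun s => laplaceDefect φ s / s) (𝓝[>] 0) (𝓝 (∫ t in Ioi (0 : ℝ), t * φ t)) := by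
  simp only [laplaceDefect, ← integral_div]
  refine tendsto_integral_filter_of_dominated_convergence (fun t => t * φ t)
    (.of_forall fun s => Measurable.aestronglyMeasurable (by fun_prop)) ?_ hint ?_
  · filter_upwards [self_mem_nhdsWithin] with s hs
    have hs : 0 < s := hs
    filter_upwards [ae_restrict_mem measurableSet_Ioi] with t ht
    have hst : 0 < s * t := mul_pos hs ht
    rw [Real.norm_of_nonneg (div_nonneg (mul_nonneg (one_sub_exp_neg_nonneg hst.le) (hnn t)) hs.le),
      div_le_iff₀ hs]
    calc (1 - Real.exp (-(s * t))) * φ t ≤ (s * t) * φ t :=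
          mul_le_mul_of_nonneg_right (one_sub_exp_neg_le _) (hnn t)
      _ = t * φ t * s := by ring
  · filter_upwards [ae_restrict_mem measurableSet_Ioi] with t ht
    have hd : HasDerivAt (fun s : ℝ => (1 - Real.exp (-(s * t))) * φ t) (t * φ t) 0 := by
      have := ((((hasDerivAt_id (0 : ℝ)).mul_const t).neg.exp).const_sub 1).mul_const (φ t)
      simpa using this
    have := (hasDerivAt_iff_tendsto_slope.1 hd).mono_left
      (nhdsWithin_mono (0 : ℝ) (fun x (hx : x ∈ Ioi (0 : ℝ)) => ne_of_gt hx))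
    refine this.congr fun s => ?_
    simp [slope_def_field]

lemma integrableOn_mul_of_tendsto (hmeas : Measurable φ) (hnn : ∀ t, 0 ≤ φ t) (hB : ∀ t, φ t ≤ B)
    (h2 : 2 < α) (hlim : Tendsto (fun t => φ t * t ^ α) atTop (𝓝 C)) :
    IntegrableOn (fun t => t * φ t) (Ioi 0) := by
  obtain ⟨K, hK⟩ := exists_le_mul_rpow_neg hnn hB (by linarith) hlim
  have hB0 : 0 ≤ B := (hnn 0).trans (hB 0)
  rw [← Ioc_union_Ioi_eq_Ioi zero_le_one]
  refine IntegrableOn.union ?_ ?_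
  · refine Measure.integrableOn_of_bounded (M := B) (by simp) (by fun_prop) ?_
    filter_upwards [ae_restrict_mem measurableSet_Ioc] with t ht
    rw [Real.norm_of_nonneg (mul_nonneg ht.1.le (hnn t))]
    exact (mul_le_of_le_one_left (hnn t) ht.2).trans (hB t)
  · refine Integrable.mono' ((integrableOn_Ioi_rpow_of_lt (a := 1 - α) (by linarith)
      one_pos).const_mul K) (by fun_prop) ?_
    filter_upwards [ae_restrict_mem measurableSet_Ioi] with t ht
    have ht0 : 0 < t := one_pos.trans ht
    have hp := Real.rpow_pos_of_pos ht0 α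
    rw [Real.norm_of_nonneg (mul_nonneg ht0.le (hnn t)), Real.rpow_sub ht0, Real.rpow_one,
      ← mul_div_assoc, le_div_iff₀ hp, mul_assoc, mul_comm]
    exact mul_le_mul_of_nonneg_right (hK t ht0) ht0.le

lemma integrableOn_one_sub_exp_neg_mul_rpow_neg_two {s T : ℝ} (hs : 0 < s) (hT : 0 < T) :
    IntegrableOn (fun t => (1 - Real.exp (-(s * t))) * t ^ (-2 : ℝ)) (Ioi T) := by
  refine Integrable.mono' (integrableOn_Ioi_rpow_of_lt (a := -2) (by norm_num) hT)
    (by fun_prop) ?_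
  filter_upwards [ae_restrict_mem measurableSet_Ioi] with t ht
  have ht0 : 0 < t := hT.trans ht
  rw [Real.norm_of_nonneg (mul_nonneg (one_sub_exp_neg_nonneg (mul_pos hs ht0).le)
    (Real.rpow_nonneg ht0.le _))]
  exact mul_le_of_le_one_left (Real.rpow_nonneg ht0.le _) (one_sub_exp_neg_le_one _)

/-- Split at `1/s`. Below, the integrand is `s / t` up to `s ^ 2 / 2`, costing at most `s / 2` in
total; above, it is at most `t^{-2}`, whose tail integral is `s`. -/
lemma abs_integral_one_sub_exp_neg_mul_rpow_neg_two_sub_le {s T : ℝ} (hs : 0 < s) (hT : 0 < T)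
    (hsT : T ≤ s⁻¹) :
    |(∫ t in Ioi T, (1 - Real.exp (-(s * t))) * t ^ (-2 : ℝ)) - s * Real.log (s⁻¹ / T)| ≤ s := by
  have hi := integrableOn_one_sub_exp_neg_mul_rpow_neg_two hs hT
  have hs' : 0 < s⁻¹ := inv_pos.2 hs
  have hinv : IntegrableOn (fun t : ℝ => s * t⁻¹) (Ioc T s⁻¹) := by
    rw [← intervalIntegrable_iff_integrableOn_Ioc_of_le hsT]
    refine (intervalIntegral.intervalIntegrable_inv (fun x hx => ?_) continuousOn_id).const_mul s
    rw [uIcc_of_le hsT] at hx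
    exact (hT.trans_le hx.1).ne'
  have hlog : ∫ t in Ioc T s⁻¹, s * t⁻¹ = s * Real.log (s⁻¹ / T) := by
    rw [integral_const_mul, ← intervalIntegral.integral_of_le hsT, integral_inv_of_pos hT hs']
  have hpow : ∀ t : ℝ, 0 < t → t ^ (-2 : ℝ) = (t ^ 2)⁻¹ := fun t ht => by
    rw [Real.rpow_neg ht.le]; norm_num
  have htail : ∫ t in Ioi s⁻¹, t ^ (-2 : ℝ) = s := by
    rw [integral_Ioi_rpow_of_lt (by norm_num) hs']
    norm_num [Real.rpow_neg hs'.le]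
  rw [← Ioc_union_Ioi_eq_Ioi hsT] at hi ⊢
  have hiA := hi.mono_set subset_union_left
  have hiB := hi.mono_set subset_union_right
  rw [setIntegral_union (Ioc_disjoint_Ioi le_rfl) measurableSet_Ioi hiA hiB]
  have hA1 : ∫ t in Ioc T s⁻¹, (1 - Real.exp (-(s * t))) * t ^ (-2 : ℝ) ≤
      s * Real.log (s⁻¹ / T) := by
    rw [← hlog]
    refine setIntegral_mono_on hiA hinv measurableSet_Ioc fun t ht => ?_
    have ht0 : 0 < t := hT.trans ht.1
    rw [hpow t ht0]
    calc (1 - Real.exp (-(s * t))) * (t ^ 2)⁻¹ ≤ (s * t) * (t ^ 2)⁻¹ :=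
          mul_le_mul_of_nonneg_right (one_sub_exp_neg_le _) (by positivity)
      _ = s * t⁻¹ := by field_simp
  have hA2 : s * Real.log (s⁻¹ / T) - s ≤
      ∫ t in Ioc T s⁻¹, (1 - Real.exp (-(s * t))) * t ^ (-2 : ℝ) := by
    have hconst : IntegrableOn (fun _ : ℝ => s ^ 2 / 2) (Ioc T s⁻¹) := by simp
    calc s * Real.log (s⁻¹ / T) - s ≤ ∫ t in Ioc T s⁻¹, (s * t⁻¹ - s ^ 2 / 2) := by
          rw [integral_sub hinv hconst, hlog, setIntegral_const, measureReal_def, Real.volume_Ioc,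
            ENNReal.toReal_ofReal (by linarith), smul_eq_mul]
          have : (s⁻¹ - T) * (s ^ 2 / 2) = s / 2 - T * (s ^ 2 / 2) := by field_simp
          have : 0 ≤ T * (s ^ 2 / 2) := by positivity
          linarith
      _ ≤ _ := by
          refine setIntegral_mono_on (hinv.sub hconst) hiA measurableSet_Ioc fun t ht => ?_
          have ht0 : 0 < t := hT.trans ht.1
          rw [hpow t ht0]
          calc s * t⁻¹ - s ^ 2 / 2 = (s * t - (s * t) ^ 2 / 2) * (t ^ 2)⁻¹ := by field_simp
            _ ≤ _ := mul_le_mul_of_nonneg_right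
                (sub_sq_div_two_le_one_sub_exp_neg (by positivity)) (by positivity)
  have hB1 : ∫ t in Ioi s⁻¹, (1 - Real.exp (-(s * t))) * t ^ (-2 : ℝ) ≤ s := by
    conv_rhs => rw [← htail]
    refine setIntegral_mono_on hiB (integrableOn_Ioi_rpow_of_lt (by norm_num) hs')
      measurableSet_Ioi fun t ht => ?_
    exact mul_le_of_le_one_left (Real.rpow_nonneg (hs'.trans ht).le _) (one_sub_exp_neg_le_one _)
  have hB2 : 0 ≤ ∫ t in Ioi s⁻¹, (1 - Real.exp (-(s * t))) * t ^ (-2 : ℝ) := by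
    refine setIntegral_nonneg measurableSet_Ioi fun t ht => ?_
    have ht0 : 0 < t := hs'.trans ht
    exact mul_nonneg (one_sub_exp_neg_nonneg (by positivity)) (Real.rpow_nonneg ht0.le _)
  rw [abs_le]
  constructor <;> linarith

lemma tendsto_integral_one_sub_exp_neg_mul_rpow_neg_two_div {T : ℝ} (hT : 0 < T) :
    Tendsto (fun s => (∫ t in Ioi T, (1 - Real.exp (-(s * t))) * t ^ (-2 : ℝ)) /
      (s * -Real.log s)) (𝓝[>] 0) (𝓝 1) := by
  have hlog : Tendsto (fun s => -Real.log s) (𝓝[>] 0) atTop :=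
    tendsto_neg_atBot_atTop.comp Real.tendsto_log_nhdsGT_zero
  have hinv : Tendsto (fun s => (-Real.log s)⁻¹) (𝓝[>] 0) (𝓝 0) := tendsto_inv_atTop_zero.comp hlog
  rw [tendsto_iff_dist_tendsto_zero]
  have hbound : Tendsto (fun s => (1 + |Real.log T|) * (-Real.log s)⁻¹) (𝓝[>] 0) (𝓝 0) := by
    simpa using hinv.const_mul (1 + |Real.log T|)
  refine squeeze_zero' (.of_forall fun _ => dist_nonneg) ?_ hbound
  filter_upwards [self_mem_nhdsWithin, hlog.eventually_gt_atTop 0,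
    tendsto_inv_nhdsGT_zero.eventually_ge_atTop T] with s hs hl hsT
  have hs : 0 < s := hs
  have h := abs_integral_one_sub_exp_neg_mul_rpow_neg_two_sub_le hs hT hsT
  set I := ∫ t in Ioi T, (1 - Real.exp (-(s * t))) * t ^ (-2 : ℝ)
  rw [Real.log_div (inv_pos.2 hs).ne' hT.ne', Real.log_inv] at h
  have hsl : 0 < s * -Real.log s := mul_pos hs hl
  rw [Real.dist_eq, div_sub_one hsl.ne', abs_div, abs_of_pos hsl, div_le_iff₀ hsl]
  calc |I - s * -Real.log s|
      = |(I - s * (-Real.log s - Real.log T)) - s * Real.log T| := by congr 1; ring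
    _ ≤ s + s * |Real.log T| := by
        refine (abs_sub _ _).trans (add_le_add h ?_)
        rw [abs_mul, abs_of_pos hs]
    _ = (1 + |Real.log T|) * (-Real.log s)⁻¹ * (s * -Real.log s) := by
        rw [mul_left_comm, mul_assoc (1 + |Real.log T|), inv_mul_cancel₀ hl.ne']
        ring

/-- Beyond a large `T`, `φ` is `C t^{-2}` up to `(ε/3) t^{-2}`, which produces the logarithm. The
part on `(0, T]` is at most `s T`, negligible against `s log (1/s)`. -/
lemma tendsto_laplaceDefect_div_mul_log (hnn : ∀ t, 0 ≤ φ t) (hi : IntegrableOn φ (Ioi 0))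
    (h1 : ∫ t in Ioi (0 : ℝ), φ t = 1)
    (hlim : Tendsto (fun t => φ t * t ^ (2 : ℝ)) atTop (𝓝 C)) :
    Tendsto (fun s => laplaceDefect φ s / (s * -Real.log s)) (𝓝[>] 0) (𝓝 C) := by
  have hlog : Tendsto (fun s => -Real.log s) (𝓝[>] 0) atTop :=
    tendsto_neg_atBot_atTop.comp Real.tendsto_log_nhdsGT_zero
  have hinv : Tendsto (fun s => (-Real.log s)⁻¹) (𝓝[>] 0) (𝓝 0) := tendsto_inv_atTop_zero.comp hlog
  rw [Metric.tendsto_nhds]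
  intro ε hε
  obtain ⟨T₀, hT₀⟩ := eventually_atTop.1 ((Metric.tendsto_nhds.1 hlim) (ε / 3) (by positivity))
  set T := max T₀ 1
  have hT : 0 < T := one_pos.trans_le (le_max_right _ _)
  have hφT : ∀ t ∈ Ioi T, |φ t - C * t ^ (-2 : ℝ)| ≤ ε / 3 * t ^ (-2 : ℝ) := by
    intro t ht
    have ht0 : 0 < t := hT.trans ht
    have h := (hT₀ t ((le_max_left _ _).trans (le_of_lt ht))).le
    have hp : t ^ (2 : ℝ) * t ^ (-2 : ℝ) = 1 := by rw [← Real.rpow_add ht0]; norm_num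
    rw [Real.dist_eq] at h
    calc |φ t - C * t ^ (-2 : ℝ)| = |(φ t * t ^ (2 : ℝ) - C) * t ^ (-2 : ℝ)| := by
          rw [sub_mul, mul_assoc, hp, mul_one]
      _ = |φ t * t ^ (2 : ℝ) - C| * t ^ (-2 : ℝ) := by
          rw [abs_mul, abs_of_nonneg (Real.rpow_nonneg ht0.le _)]
      _ ≤ _ := mul_le_mul_of_nonneg_right h (Real.rpow_nonneg ht0.le _)
  have hR := tendsto_integral_one_sub_exp_neg_mul_rpow_neg_two_div hT
  have herr : Tendsto (fun s => T * (-Real.log s)⁻¹ + |C| *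
      |(∫ t in Ioi T, (1 - Real.exp (-(s * t))) * t ^ (-2 : ℝ)) / (s * -Real.log s) - 1| +
      ε / 3 * ((∫ t in Ioi T, (1 - Real.exp (-(s * t))) * t ^ (-2 : ℝ)) / (s * -Real.log s)))
      (𝓝[>] 0) (𝓝 (ε / 3)) := by
    have := ((hinv.const_mul T).add (((hR.sub_const 1).abs).const_mul |C|)).add
      (hR.const_mul (ε / 3))
    simpa using this
  filter_upwards [self_mem_nhdsWithin, hlog.eventually_gt_atTop 0,
    herr.eventually_lt_const (by linarith : ε / 3 < ε)] with s hs hl hlt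
  have hs : 0 < s := hs
  refine lt_of_le_of_lt ?_ hlt
  have hsl : 0 < s * -Real.log s := mul_pos hs hl
  set R := ∫ t in Ioi T, (1 - Real.exp (-(s * t))) * t ^ (-2 : ℝ) with hRdef
  have hRi := integrableOn_one_sub_exp_neg_mul_rpow_neg_two hs hT
  have hint : IntegrableOn (fun t => (1 - Real.exp (-(s * t))) * φ t) (Ioi 0) := by
    simp only [sub_mul, one_mul]
    exact hi.sub (integrableOn_exp_neg_mul_mul hi hs.le)
  have hintA := hint.mono_set (Ioc_subset_Ioi_self : Ioc 0 T ⊆ Ioi 0)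
  have hintB := hint.mono_set (Ioi_subset_Ioi hT.le)
  have hsplit : laplaceDefect φ s = (∫ t in Ioc 0 T, (1 - Real.exp (-(s * t))) * φ t) +
      ∫ t in Ioi T, (1 - Real.exp (-(s * t))) * φ t := by
    rw [laplaceDefect, ← setIntegral_union (Ioc_disjoint_Ioi le_rfl) measurableSet_Ioi hintA hintB,
      Ioc_union_Ioi_eq_Ioi hT.le]
  have hA0 : 0 ≤ ∫ t in Ioc 0 T, (1 - Real.exp (-(s * t))) * φ t :=
    setIntegral_nonneg measurableSet_Ioc fun t ht =>
      mul_nonneg (one_sub_exp_neg_nonneg (mul_pos hs ht.1).le) (hnn t)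
  have hA1 : ∫ t in Ioc 0 T, (1 - Real.exp (-(s * t))) * φ t ≤ s * T := by
    calc ∫ t in Ioc 0 T, (1 - Real.exp (-(s * t))) * φ t ≤ ∫ t in Ioc 0 T, s * T * φ t := by
          refine setIntegral_mono_on hintA ((hi.mono_set Ioc_subset_Ioi_self).const_mul _)
            measurableSet_Ioc fun t ht => mul_le_mul_of_nonneg_right ?_ (hnn t)
          exact (one_sub_exp_neg_le _).trans (mul_le_mul_of_nonneg_left ht.2 hs.le)
      _ ≤ ∫ t in Ioi 0, s * T * φ t :=
          setIntegral_mono_set (hi.const_mul _)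
            (.of_forall fun t => mul_nonneg (by positivity) (hnn t)) Ioc_subset_Ioi_self.eventuallyLE
      _ = s * T := by rw [integral_const_mul, h1, mul_one]
  have hBC : |(∫ t in Ioi T, (1 - Real.exp (-(s * t))) * φ t) - C * R| ≤ ε / 3 * R := by
    rw [hRdef, ← integral_const_mul, ← integral_const_mul, ← integral_sub hintB (hRi.const_mul C),
      ← Real.norm_eq_abs]
    refine norm_integral_le_of_norm_le (hRi.const_mul _) ?_
    filter_upwards [ae_restrict_mem measurableSet_Ioi] with t ht
    have h0 := one_sub_exp_neg_nonneg (mul_pos hs (hT.trans ht)).le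
    rw [mul_left_comm C, ← mul_sub, norm_mul, Real.norm_of_nonneg h0, mul_left_comm (ε / 3)]
    exact mul_le_mul_of_nonneg_left (hφT t ht) h0
  set I₁ := ∫ t in Ioc 0 T, (1 - Real.exp (-(s * t))) * φ t
  set I₂ := ∫ t in Ioi T, (1 - Real.exp (-(s * t))) * φ t
  rw [Real.dist_eq, hsplit]
  calc |(I₁ + I₂) / (s * -Real.log s) - C|
      = |I₁ / (s * -Real.log s) + C * (R / (s * -Real.log s) - 1) +
          (I₂ - C * R) / (s * -Real.log s)| := by congr 1; ring
    _ ≤ |I₁ / (s * -Real.log s)| + |C * (R / (s * -Real.log s) - 1)| +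
          |(I₂ - C * R) / (s * -Real.log s)| := abs_add_three _ _ _
    _ ≤ _ := by
        rw [abs_mul C, abs_div, abs_div, abs_of_pos hsl, abs_of_nonneg hA0, ← mul_div_assoc]
        gcongr
        rw [div_le_iff₀ hsl]
        calc I₁ ≤ s * T := hA1
          _ = T * (-Real.log s)⁻¹ * (s * -Real.log s) := by
            rw [mul_left_comm, mul_assoc T, inv_mul_cancel₀ hl.ne', mul_one]

end LaplaceDefectAsymptotics

/-! ### From the defect to the growth of the exponential moment -/

section MainResult

open Set Topology

/-- A renewal function is asymptotically the reciprocal of a regularly varying equivalent of the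
Laplace defect of its density. -/
lemma IsRenewalFunction.tendsto_mul {φ M g : ℝ → ℝ} {L ρ : ℝ} (h : IsRenewalFunction φ M)
    (hL : 0 < L) (hρ : 0 ≤ ρ)
    (hlim : Tendsto (fun s => laplaceDefect φ s / g s) (𝓝[>] 0) (𝓝 L))
    (hg : ∀ᶠ s in 𝓝[>] 0, 0 < g s)
    (hreg : ∀ n : ℕ, Tendsto (fun s => g s / g ((n + 1) * s)) (𝓝[>] 0) (𝓝 ((n + 1 : ℝ) ^ (-ρ)))) :
    Tendsto (fun t => M t * g t⁻¹) atTop (𝓝 (1 / (L * Real.Gamma (ρ + 1)))) := by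
  have hD : ∀ s, 0 < s → 0 < laplaceDefect φ s := fun s hs =>
    laplaceDefect_pos h.density_nonneg h.density_integrable h.density_integral hs
  have hscale (n : ℕ) : Tendsto (fun s : ℝ => ((n : ℝ) + 1) * s) (𝓝[>] 0) (𝓝[>] 0) := by
    have hn : (0 : ℝ) < n + 1 := by positivity
    refine tendsto_nhdsWithin_of_tendsto_nhds_of_eventually_within _ ?_ ?_
    · have : Tendsto (fun s : ℝ => ((n : ℝ) + 1) * s) (𝓝 0) (𝓝 (((n : ℝ) + 1) * 0)) :=
        tendsto_id.const_mul _
      rw [mul_zero] at this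
      exact this.mono_left nhdsWithin_le_nhds
    · filter_upwards [self_mem_nhdsWithin] with s hs using mul_pos hn hs
  -- The defect is asymptotic to `L g`, so it inherits the regular variation of `g`.
  have hA : ∀ n : ℕ, Tendsto (fun s => (1 / laplaceDefect φ ((n + 1) * s)) /
      (1 / laplaceDefect φ s)) (𝓝[>] 0) (𝓝 ((n + 1 : ℝ) ^ (-ρ))) := by
    intro n
    have h2 := (hlim.div (hlim.comp (hscale n)) hL.ne').mul (hreg n)
    rw [div_self hL.ne', one_mul] at h2
    refine h2.congr' ?_
    filter_upwards [hg, (hscale n).eventually hg, self_mem_nhdsWithin] with s h3 h4 hs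
    have h5 := hD s hs
    have h6 := hD _ (mul_pos (by positivity : (0 : ℝ) < n + 1) hs)
    simp only [Pi.div_apply, Function.comp_apply]
    field_simp
  have hmain := tendsto_div_of_laplace_regularlyVarying (A := fun s => 1 / laplaceDefect φ s)
    h.monotone (fun t => (h.pos t).le) (fun s hs => one_div_pos.2 (hD s hs))
    (fun s hs => h.integrableOn_exp_neg_mul_mul hs) (fun s hs => h.mul_laplace_eq hs) hρ hA
  have hinv := tendsto_inv_atTop_nhdsGT_zero (𝕜 := ℝ)
  have h7 := hmain.div (hlim.comp hinv) hL.ne'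
  rw [div_div, mul_comm] at h7
  refine h7.congr' ?_
  filter_upwards [hinv.eventually hg, eventually_gt_atTop 0] with t h8 ht
  have h9 := hD _ (inv_pos.2 ht)
  simp only [Pi.div_apply, Function.comp_apply]
  generalize laplaceDefect φ t⁻¹ = d at *
  generalize g t⁻¹ = e at *
  field_simp

lemma tendsto_rpow_div_rpow {ρ : ℝ} (n : ℕ) :
    Tendsto (fun s : ℝ => s ^ ρ / ((n + 1) * s) ^ ρ) (𝓝[>] 0) (𝓝 ((n + 1 : ℝ) ^ (-ρ))) := by
  refine tendsto_const_nhds.congr' ?_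
  filter_upwards [self_mem_nhdsWithin] with s hs
  have hs : 0 < s := hs
  have hn : (0 : ℝ) < n + 1 := by positivity
  have h1 := Real.rpow_pos_of_pos hs ρ
  rw [Real.mul_rpow hn.le hs.le, Real.rpow_neg hn.le]
  field_simp

/-- `log ((n+1) s) = log s + log (n+1)`, and the constant is negligible against `log s`. -/
lemma tendsto_mul_log_div_mul_log (n : ℕ) :
    Tendsto (fun s : ℝ => (s * -Real.log s) / ((n + 1) * s * -Real.log ((n + 1) * s))) (𝓝[>] 0)
      (𝓝 ((n + 1 : ℝ) ^ (-1 : ℝ))) := by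
  have hn : (0 : ℝ) < n + 1 := by positivity
  have hlog : Tendsto (fun s => -Real.log s) (𝓝[>] 0) atTop :=
    tendsto_neg_atBot_atTop.comp Real.tendsto_log_nhdsGT_zero
  have hinv : Tendsto (fun s => (-Real.log s)⁻¹) (𝓝[>] 0) (𝓝 0) := tendsto_inv_atTop_zero.comp hlog
  have h1 := ((hinv.const_mul (Real.log (n + 1))).const_sub 1).inv₀ (by simp)
  have h2 := h1.const_mul ((n : ℝ) + 1)⁻¹
  rw [mul_zero, sub_zero, inv_one, mul_one] at h2
  rw [Real.rpow_neg_one]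
  refine h2.congr' ?_
  filter_upwards [self_mem_nhdsWithin, hlog.eventually_gt_atTop 0,
    hlog.eventually_gt_atTop (Real.log (n + 1))] with s hs hl hl'
  have hs : 0 < s := hs
  rw [Real.log_mul hn.ne' hs.ne', neg_add_rev]
  generalize Real.log (n + 1 : ℝ) = b at *
  generalize -Real.log s = x at *
  have hxb : 0 < x - b := sub_pos.2 hl'
  have h3 : 1 - b * x⁻¹ = (x - b) / x := by rw [sub_div, div_self hl.ne', div_eq_mul_inv]
  rw [h3, ← sub_eq_add_neg]
  field_simp

lemma IsTransitionFunction.le_one {S : Type*} {p : ℝ≥0 → S → S → ℝ} (hp : IsTransitionFunction p) (t : ℝ≥0)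
    (i j : S) : p t i j ≤ 1 :=
  le_hasSum (hp.hasSum_one t i) j fun k _ => hp.nonneg t i k

section

variable {S Ω : Type*} [MeasurableSpace S] [DiscreteMeasurableSpace S] [MeasurableSpace Ω]
  {P : Measure Ω} {X : ℝ≥0 → Ω → S} {p : ℝ≥0 → S → S → ℝ} {i : S}

lemma localTime_mono (hX : IsMarkovProcess P X p i) (ω : Ω) :
    Monotone fun t : ℝ≥0 => localTime X i t ω := by
  intro s t hst
  simp only [localTime_eq]
  have hm : Measurable fun u => visitIndicator X i u ω :=
    hX.measurable_visitIndicator.comp (g := fun z : ℝ × Ω => visitIndicator X i z.1 z.2)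
      (f := fun u : ℝ => (u, ω)) (by fun_prop)
  exact intervalIntegral.integral_mono_interval le_rfl s.2 (by exact_mod_cast hst)
    (.of_forall fun u => (visitIndicator_mem_Icc X i u ω).1)
    (intervalIntegrable_of_mem_Icc hm (fun u => visitIndicator_mem_Icc X i u ω) _ _)

variable [IsProbabilityMeasure P]

/-- Measurability of `p` in time is not part of the transition function; it comes from joint
measurability of `X`. -/
lemma IsMarkovProcess.measurable_returnProbability (hX : IsMarkovProcess P X p i)
    (hp : IsTransitionFunction p) : Measurable fun t : ℝ => p t.toNNReal i i := by
  have hA : MeasurableSet {z : ℝ≥0 × Ω | X z.1 z.2 = i} :=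
    hX.measurable (MeasurableSet.of_discrete (s := {i}))
  have h1 : Measurable fun t : ℝ≥0 => P {ω | X t ω = i} := measurable_measure_prodMk_left hA
  have h2 : (fun t : ℝ≥0 => (P {ω | X t ω = i}).toReal) = fun t => p t i i := by
    ext t
    rw [hX.measure_eq, ENNReal.toReal_ofReal (hp.nonneg _ _ _)]
  have h3 : Measurable fun t : ℝ≥0 => p t i i := h2 ▸ h1.ennreal_toReal
  exact h3.comp measurable_real_toNNReal

lemma integrable_exp_localTime (hX : IsMarkovProcess P X p i) (κ : ℝ) (t : ℝ≥0) :
    Integrable (fun ω => Real.exp (κ * localTime X i t ω)) P := by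
  have hm := measurable_intervalIntegral_of_uncurry hX.measurable_visitIndicator 0 t
  refine Integrable.of_bound (C := Real.exp (|κ| * t)) ?_ (.of_forall fun ω => ?_)
  · exact (Real.measurable_exp.comp (hm.const_mul κ)).aestronglyMeasurable
  · rw [Real.norm_of_nonneg (Real.exp_pos _).le, Real.exp_le_exp]
    refine (le_abs_self _).trans ?_
    rw [abs_mul, localTime_eq]
    have := abs_intervalIntegral_le_of_mem_Icc (fun s => visitIndicator_mem_Icc X i s ω) 0 t
    rw [sub_zero, abs_of_nonneg t.coe_nonneg] at this
    exact mul_le_mul_of_nonneg_left this (abs_nonneg κ)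

lemma isRenewalFunction_integral_exp_localTime (hX : IsMarkovProcess P X p i)
    (hp : IsTransitionFunction p) {κ : ℝ} (hκ : 0 < κ)
    (hcrit : ENNReal.ofReal κ = 1 / greenFunction p i i) :
    IsRenewalFunction (fun t => κ * p t.toNNReal i i)
      (fun t => ∫ ω, Real.exp (κ * localTime X i t.toNNReal ω) ∂P) := by
  have hmeas := hX.measurable_returnProbability hp
  -- Since `κ > 0`, this also forces `G_∞` to be finite.
  have hG : greenFunction p i i = (ENNReal.ofReal κ)⁻¹ := by
    rw [hcrit, one_div, inv_inv]
  have hlint : ∫⁻ t in Ioi (0 : ℝ), ENNReal.ofReal (p t.toNNReal i i) = (ENNReal.ofReal κ)⁻¹ := by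
    rw [← hG, greenFunction, setLIntegral_congr Ioi_ae_eq_Ici]
  have hint : IntegrableOn (fun t : ℝ => p t.toNNReal i i) (Ioi 0) := by
    refine ⟨hmeas.aestronglyMeasurable, ?_⟩
    rw [hasFiniteIntegral_iff_ofReal (.of_forall fun t => hp.nonneg _ _ _), hlint]
    simpa using hκ
  have hval : ∫ t in Ioi (0 : ℝ), p t.toNNReal i i = κ⁻¹ := by
    rw [integral_eq_lintegral_of_nonneg_ae (.of_forall fun t => hp.nonneg _ _ _)
      hmeas.aestronglyMeasurable, hlint, ENNReal.toReal_inv, ENNReal.toReal_ofReal hκ.le]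
  refine ⟨fun t => mul_nonneg hκ.le (hp.nonneg _ _ _), hint.const_mul κ, ?_, ?_, fun t => ?_,
    fun t ht => hX.renewal_equation hp κ ht⟩
  · rw [integral_const_mul, hval, mul_inv_cancel₀ hκ.ne']
  · intro s t hst
    refine integral_mono (integrable_exp_localTime hX κ _) (integrable_exp_localTime hX κ _)
      fun ω => ?_
    exact Real.exp_le_exp.2 (mul_le_mul_of_nonneg_left
      (localTime_mono hX ω (Real.toNNReal_le_toNNReal hst)) hκ.le)
  · exact integral_exp_pos (integrable_exp_localTime hX κ _)

end

/-- Passes from `g` at `s = 1/t` to the growth function `v t = 1 / g (1/t)`. -/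
lemma isEquivalent_of_tendsto_mul {F : ℝ≥0 → ℝ} {v g : ℝ → ℝ} {C : ℝ} (hC : C ≠ 0)
    (hvg : ∀ᶠ t in atTop, v t * g t⁻¹ = 1)
    (h : Tendsto (fun t : ℝ => F t.toNNReal * g t⁻¹) atTop (𝓝 C)) :
    F ~[atTop] fun t : ℝ≥0 => v t * C := by
  refine isEquivalent_of_tendsto_one ?_
  have hcoe : Tendsto (fun t : ℝ≥0 => (t : ℝ)) atTop atTop := NNReal.tendsto_coe_atTop.2 tendsto_id
  have h1 := (h.div_const C).comp hcoe
  rw [div_self hC] at h1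
  refine h1.congr' ?_
  filter_upwards [hcoe.eventually hvg] with t ht
  simp only [Function.comp_apply, Pi.div_apply, Real.toNNReal_coe]
  rw [eq_inv_of_mul_eq_one_right ht, div_mul_eq_div_div, div_eq_mul_inv (F t)]

end MainResult

end CriticalLocalTime

theorem mainTheorem9 {S : Type*} [Countable S] [MeasurableSpace S] [DiscreteMeasurableSpace S]
    {Ω : Type*} [MeasurableSpace Ω] (P : Measure Ω) [IsProbabilityMeasure P]
    (a : S → S → ℝ) (p : ℝ≥0 → S → S → ℝ) (X : ℝ≥0 → Ω → S) (i : S)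
    (hp : CriticalLocalTime.IsTransitionFunction p)
    (ha : CriticalLocalTime.HasTransitionRates a p)
    (hX : CriticalLocalTime.IsMarkovProcess P X p i)
    (c α : ℝ) (hc : 0 < c)
    (hpα : (fun t : ℝ≥0 => p t i i) ~[atTop] fun t : ℝ≥0 => c * (t : ℝ) ^ (-α))
    (κ : ℝ) (hκ : 0 < κ)
    (hcrit : ENNReal.ofReal κ = 1 / CriticalLocalTime.greenFunction p i i) :
    (1 < α → α < 2 →
      (fun t : ℝ≥0 => ∫ ω, Real.exp (κ * CriticalLocalTime.localTime X i t ω) ∂P) ~[atTop]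
        fun t : ℝ≥0 => (t : ℝ) ^ (α - 1) *
          ((α - 1) / (κ * c * Real.Gamma (2 - α) * Real.Gamma α))) ∧
    (α = 2 →
      (fun t : ℝ≥0 => ∫ ω, Real.exp (κ * CriticalLocalTime.localTime X i t ω) ∂P) ~[atTop]
        fun t : ℝ≥0 => (t : ℝ) / Real.log t * (1 / (κ * c))) ∧
    (2 < α →
      CriticalLocalTime.weightedGreenFunction p i i ≠ ∞ ∧
      (fun t : ℝ≥0 => ∫ ω, Real.exp (κ * CriticalLocalTime.localTime X i t ω) ∂P) ~[atTop]
        fun t : ℝ≥0 => (t : ℝ) *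
          (1 / (κ * (CriticalLocalTime.weightedGreenFunction p i i).toReal))) := by
  open CriticalLocalTime Set Topology in
  have hren := isRenewalFunction_integral_exp_localTime hX hp hκ hcrit
  have hmeas := (hX.measurable_returnProbability hp).const_mul κ
  have hB : ∀ t : ℝ, κ * p t.toNNReal i i ≤ κ := fun t =>
    mul_le_of_le_one_right hκ.le (hp.le_one _ _ _)
  have hlim : Tendsto (fun t : ℝ => κ * p t.toNNReal i i * t ^ α) atTop (𝓝 (κ * c)) := by
    have hne : ∀ᶠ t : ℝ≥0 in atTop, c * (t : ℝ) ^ (-α) ≠ 0 := by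
      filter_upwards [eventually_gt_atTop 0] with t ht
      exact (mul_pos hc (Real.rpow_pos_of_pos (NNReal.coe_pos.2 ht) _)).ne'
    have h1 := (((isEquivalent_iff_tendsto_one hne).1 hpα).comp
      tendsto_real_toNNReal_atTop).const_mul (κ * c)
    rw [mul_one] at h1
    refine h1.congr' ?_
    filter_upwards [eventually_gt_atTop 0] with t ht
    have hp' := Real.rpow_pos_of_pos ht α
    simp only [Function.comp_apply, Pi.div_apply, Real.coe_toNNReal t ht.le, Real.rpow_neg ht.le]
    field_simp
  have hlogev : ∀ᶠ s in 𝓝[>] (0 : ℝ), 0 < s * -Real.log s := by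
    filter_upwards [Ioo_mem_nhdsGT (zero_lt_one (α := ℝ))] with s hs
    exact mul_pos hs.1 (neg_pos.2 (Real.log_neg hs.1 hs.2))
  refine ⟨fun h1 h2 => ?_, fun h2 => ?_, fun h2 => ?_⟩
  · have hG1 := Real.Gamma_pos_of_pos (by linarith : 0 < 2 - α)
    have hG2 := Real.Gamma_pos_of_pos (by linarith : 0 < α)
    have hα : 0 < α - 1 := by linarith
    have h := hren.tendsto_mul (L := κ * c * (Real.Gamma (2 - α) / (α - 1))) (by positivity) hα.le
      (tendsto_laplaceDefect_div_rpow hmeas hren.density_nonneg hB h1 h2 hlim)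
      (by filter_upwards [self_mem_nhdsWithin] with s hs using Real.rpow_pos_of_pos hs _)
      (fun n => tendsto_rpow_div_rpow n)
    have hconst : 1 / (κ * c * (Real.Gamma (2 - α) / (α - 1)) * Real.Gamma (α - 1 + 1)) =
        (α - 1) / (κ * c * Real.Gamma (2 - α) * Real.Gamma α) := by
      rw [sub_add_cancel]
      field_simp
    rw [hconst] at h
    refine isEquivalent_of_tendsto_mul (v := fun t => t ^ (α - 1))
      (g := fun s => s ^ (α - 1)) (by positivity) ?_ h
    filter_upwards [eventually_gt_atTop 0] with t ht
    rw [← Real.mul_rpow ht.le (inv_pos.2 ht).le, mul_inv_cancel₀ ht.ne', Real.one_rpow]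
  -- Here `g s = s log (1/s)`, `ρ = 1`, and `1 / g (1/t) = t / log t`.
  · subst h2
    have h := hren.tendsto_mul (ρ := 1) (mul_pos hκ hc) zero_le_one
      (tendsto_laplaceDefect_div_mul_log hren.density_nonneg hren.density_integrable
        hren.density_integral hlim) hlogev tendsto_mul_log_div_mul_log
    rw [one_add_one_eq_two, Real.Gamma_two, mul_one] at h
    refine isEquivalent_of_tendsto_mul (v := fun t => t / Real.log t)
      (g := fun s => s * -Real.log s) (by positivity) ?_ h
    filter_upwards [eventually_gt_atTop 1] with t ht
    have := Real.log_pos ht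
    rw [Real.log_inv, neg_neg]
    field_simp
  · have hint := integrableOn_mul_of_tendsto hmeas hren.density_nonneg hB h2 hlim
    have hint' : IntegrableOn (fun t : ℝ => t * p t.toNNReal i i) (Ioi 0) := by
      have := hint.const_mul κ⁻¹
      refine this.congr (.of_forall fun t => ?_)
      simp only
      field_simp
    have hnn : 0 ≤ᵐ[volume.restrict (Ioi 0)] fun t : ℝ => t * p t.toNNReal i i := by
      filter_upwards [ae_restrict_mem measurableSet_Ioi] with t ht
      exact mul_nonneg (le_of_lt ht) (hp.nonneg _ _ _)
    have hH : weightedGreenFunction p i i =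
        ENNReal.ofReal (∫ t in Ioi (0 : ℝ), t * p t.toNNReal i i) := by
      rw [weightedGreenFunction, ofReal_integral_eq_lintegral_ofReal hint' hnn,
        setLIntegral_congr Ioi_ae_eq_Ici]
    refine ⟨hH ▸ ENNReal.ofReal_ne_top, ?_⟩
    have hmul : ∫ t in Ioi (0 : ℝ), t * (κ * p t.toNNReal i i) =
        κ * (weightedGreenFunction p i i).toReal := by
      rw [hH, ENNReal.toReal_ofReal (integral_nonneg_of_ae hnn), ← integral_const_mul]
      simp only [mul_left_comm]
    have hL := tendsto_laplaceDefect_div hren.density_nonneg hint hmeas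
    rw [hmul] at hL
    -- Since `1 - e^{-t} ≤ t`, the first moment of `φ` dominates the defect at `s = 1`, which is
    -- positive.
    have hpos : 0 < κ * (weightedGreenFunction p i i).toReal := by
      rw [← hmul]
      refine (laplaceDefect_pos hren.density_nonneg hren.density_integrable hren.density_integral
        one_pos).trans_le ?_
      have hdef : IntegrableOn (fun t : ℝ => (1 - Real.exp (-(1 * t))) * (κ * p t.toNNReal i i))
          (Ioi 0) := by
        simp only [sub_mul (1 : ℝ) _ (κ * _), one_mul (κ * _)]
        exact hren.density_integrable.sub
          (integrableOn_exp_neg_mul_mul hren.density_integrable zero_le_one)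
      refine integral_mono hdef hint fun t => ?_
      exact mul_le_mul_of_nonneg_right (by simpa using one_sub_exp_neg_le t)
        (hren.density_nonneg t)
    have h := hren.tendsto_mul (ρ := 1) (g := fun s => s) hpos zero_le_one hL
      self_mem_nhdsWithin (fun n => by simpa only [Real.rpow_one] using tendsto_rpow_div_rpow (ρ := 1) n)
    rw [one_add_one_eq_two, Real.Gamma_two, mul_one] at h
    refine isEquivalent_of_tendsto_mul (v := fun t => t) (g := fun s => s)
      (one_div_pos.2 hpos).ne' ?_ h
    filter_upwards [eventually_gt_atTop 0] with t ht using mul_inv_cancel₀ ht.ne'
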